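/- For $n\ge 0$ let $\mathfrak S_n$ be the set of permutations $\sigma=\sigma(1)\cdots\sigma(n)$ of $[n]=\{1,\dots,n\}$ and, for a pattern $\tau\in\mathfrak S_3$, let $\mathfrak S_n(\tau)$ be the set of those $\sigma\in\mathfrak S_n$ having no subsequence $\sigma(i)\sigma(j)\sigma(k)$ with $i<j<k$ order-isomorphic to $\tau$. For $\sigma\in\mathfrak S_n$ define $$\mathsf{exc}\,\sigma=\#\{i:\sigma(i)>i\},\quad \mathsf{fix}\,\sigma=\#\{i:\sigma(i)=i\},\quad \mathsf{inv}\,\sigma=\#\{(i,j): i<j,\ \sigma(i)>\sigma(j)\},$$ $$\mathsf{des}\,\sigma=\#\{i\in[n-1]:\sigma(i)>\sigma(i+1)\},\qquad \mathsf{asc}\,\sigma=\#\{i\in[n-1]:\sigma(i)<\sigma(i+1)\},$$ $$\begin{aligned} (31\text{-}2)\,\sigma&=\#\{(i,j): i+1<j\le n,\ \sigma(i+1)<\sigma(j)<\sigma(i)\},\\ (2\text{-}31)\,\sigma&=\#\{(i,j): j<i<n,\ \sigma(i+1)<\sigma(j)<\sigma(i)\},\\ (2\text{-}13)\,\sigma&=\#\{(i,j):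 j<i<n,\ \sigma(i)<\sigma(j)<\sigma(i+1)\},\\ (13\text{-}2)\,\sigma&=\#\{(i,j): i+1<j\le n,\ \sigma(i)<\sigma(j)<\sigma(i+1)\}. \end{aligned}$$ With the convention $\sigma(0)=0$, $\sigma(n+1)=\infty$, let $\mathsf{fmax}\,\sigma$ (resp. $\mathsf{amin}\,\sigma$) be the number of $i\in[n]$ such that $\sigma(i-1)<\sigma(i)<\sigma(i+1)$ and $\sigma(i)$ is a left-to-right maximum (resp. right-to-left minimum) of $\sigma$. With the convention $\sigma(0)=\infty$, $\sigma(n+1)=0$, let $\mathsf{amax}\,\sigma$ (resp. $\mathsf{fmin}\,\sigma$) be the number of $i\in[n]$ such that $\sigma(i-1)>\sigma(i)>\sigma(i+1)$ and $\sigma(i)$ is a right-to-left maximum (resp. left-to-right minimum) of $\sigma$. Let $$N_n(t,q,r)=\sum_{\sigma\in\mathfrak S_n(321)}t^{\mathsf{exc}\,\sigma}q^{\mathsf{inv}\,\sigma}r^{\mathsf{fix}\,\sigma}.$$ **Theorem.** Let $n\ge 1$, and let $(\tau,\mathsf{stat}_1,\mathsf{stat}_2,\mathsf{stat}_3)$ be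 any one of the five quadruples $$\begin{aligned} &(321,\ \mathsf{exc},\ \mathsf{inv},\ \mathsf{fix}),\\ &(231,\ \mathsf{des},\ \mathsf{des}+31\text{-}2,\ \mathsf{fmax}),\\ &(132,\ \mathsf{asc},\ \mathsf{asc}+2\text{-}13,\ \mathsf{amax}),\\ &(312,\ \mathsf{des},\ \mathsf{des}+2\text{-}31,\ \mathsf{amin}),\\ &(213,\ \mathsf{asc},\ \mathsf{asc}+13\text{-}2,\ \mathsf{fmin}). \end{aligned}$$ Then, as identities of rational functions in $t$ and $q$ (equivalently, for all elements $t,q$ of an arbitrary field, with $q\ne0$ in the first identity and $t\neq 0$ in the second), $$N_n(t/q,q,1)=\sum_{\sigma\in\mathfrak S_{n-1}(\tau)}t^{\mathsf{stat}_1\sigma}\,q^{\mathsf{stat}_2\sigma}\,(1+t)^{\mathsf{stat}_3\sigma},$$ $$N_n(t,q,t)=t^n\sum_{\sigma\in\mathfrak S_{n-1}(\tau)}(q/t)^{\mathsf{stat}_1\sigma}\,q^{\mathsf{stat}_2\sigma}\,(1+q/t)^{\mathsf{stat}_3\sigma}.$$ (By the definition of $N_{n-1}$, for the first quadruple the first identity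 reads $N_n(t/q,q,1)=N_{n-1}(t,q,1+t)$.) -/

import Mathlib

namespace QNarayana

/-! Permutations of `[n]` are elements of `Equiv.Perm (Fin n)`: the letter `j + 1` stands at
position `i + 1` exactly when `σ i = j`. -/

/-- `σ` contains the pattern `τ` (written as the word `τ 0, τ 1, …, τ (k-1)`): some subsequence
of `σ` is order-isomorphic to `τ`. -/
def Contains {n k : ℕ} (σ : Equiv.Perm (Fin n)) (τ : Fin k → ℕ) : Prop :=
  ∃ f : Fin k → Fin n, StrictMono f ∧ ∀ a b : Fin k, σ (f a) < σ (f b) ↔ τ a < τ b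

open Classical in
/-- The set of permutations of `[n]` that avoid the pattern `τ`. -/
noncomputable def avoiders (n : ℕ) {k : ℕ} (τ : Fin k → ℕ) : Finset (Equiv.Perm (Fin n)) :=
  Finset.univ.filter fun σ => ¬ Contains σ τ

section Statistics

variable {n : ℕ}

/-- Number of excedances. -/
noncomputable def exc (σ : Equiv.Perm (Fin n)) : ℕ := Nat.card {i : Fin n // i < σ i}

/-- Number of fixed points. -/
noncomputable def fix (σ : Equiv.Perm (Fin n)) : ℕ := Nat.card {i : Fin n // σ i = i}

/-- Number of inversions. -/
noncomputable def inv (σ : Equiv.Perm (Fin n)) : ℕ :=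
  Nat.card {p : Fin n × Fin n // p.1 < p.2 ∧ σ p.2 < σ p.1}

/-- Number of descents. -/
noncomputable def des (σ : Equiv.Perm (Fin n)) : ℕ :=
  Nat.card {i : Fin n // ∃ h : i.val + 1 < n, σ ⟨i.val + 1, h⟩ < σ i}

/-- Number of ascents. -/
noncomputable def asc (σ : Equiv.Perm (Fin n)) : ℕ :=
  Nat.card {i : Fin n // ∃ h : i.val + 1 < n, σ i < σ ⟨i.val + 1, h⟩}

/-- Number of occurrences `(i, j)` of the vincular pattern `31-2`:
`i + 1 < j` and `σ (i + 1) < σ j < σ i`. -/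
noncomputable def vinc31_2 (σ : Equiv.Perm (Fin n)) : ℕ :=
  Nat.card {p : Fin n × Fin n // ∃ h : p.1.val + 1 < n, p.1.val + 1 < p.2.val ∧
    σ ⟨p.1.val + 1, h⟩ < σ p.2 ∧ σ p.2 < σ p.1}

/-- Number of occurrences `(i, j)` of the vincular pattern `2-31`:
`j < i` and `σ (i + 1) < σ j < σ i`. -/
noncomputable def vinc2_31 (σ : Equiv.Perm (Fin n)) : ℕ :=
  Nat.card {p : Fin n × Fin n // ∃ h : p.1.val + 1 < n, p.2 < p.1 ∧
    σ ⟨p.1.val + 1, h⟩ < σ p.2 ∧ σ p.2 < σ p.1}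

/-- Number of occurrences `(i, j)` of the vincular pattern `2-13`:
`j < i` and `σ i < σ j < σ (i + 1)`. -/
noncomputable def vinc2_13 (σ : Equiv.Perm (Fin n)) : ℕ :=
  Nat.card {p : Fin n × Fin n // ∃ h : p.1.val + 1 < n, p.2 < p.1 ∧
    σ p.1 < σ p.2 ∧ σ p.2 < σ ⟨p.1.val + 1, h⟩}

/-- Number of occurrences `(i, j)` of the vincular pattern `13-2`:
`i + 1 < j` and `σ i < σ j < σ (i + 1)`. -/
noncomputable def vinc13_2 (σ : Equiv.Perm (Fin n)) : ℕ :=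
  Nat.card {p : Fin n × Fin n // ∃ h : p.1.val + 1 < n, p.1.val + 1 < p.2.val ∧
    σ p.1 < σ p.2 ∧ σ p.2 < σ ⟨p.1.val + 1, h⟩}

/-- The letter of `σ` at the (one-based) position `m`, with the convention that the letter at
position `0` is `a` and the letter at positions beyond `n` is `b`. -/
def letter (a b : ℕ∞) (σ : Equiv.Perm (Fin n)) (m : ℕ) : ℕ∞ :=
  if m = 0 then a
  else if h : m - 1 < n then (((σ ⟨m - 1, h⟩).val + 1 : ℕ) : ℕ∞)
  else b

/-- Double ascent at `i`, with the boundary convention `σ(0) = 0`, `σ(n+1) = ∞`. -/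
def IsLda (σ : Equiv.Perm (Fin n)) (i : Fin n) : Prop :=
  letter 0 ⊤ σ i.val < letter 0 ⊤ σ (i.val + 1) ∧
    letter 0 ⊤ σ (i.val + 1) < letter 0 ⊤ σ (i.val + 2)

/-- Double descent at `i`, with the boundary convention `σ(0) = ∞`, `σ(n+1) = 0`. -/
def IsRdd (σ : Equiv.Perm (Fin n)) (i : Fin n) : Prop :=
  letter ⊤ 0 σ (i.val + 1) < letter ⊤ 0 σ i.val ∧
    letter ⊤ 0 σ (i.val + 2) < letter ⊤ 0 σ (i.val + 1)

/-- Number of foremaxima: double ascents (convention `0`–`∞`) that are left-to-right maxima. -/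
noncomputable def fmax (σ : Equiv.Perm (Fin n)) : ℕ :=
  Nat.card {i : Fin n // IsLda σ i ∧ ∀ j, j ≤ i → σ j ≤ σ i}

/-- Number of afterminima: double ascents (convention `0`–`∞`) that are right-to-left minima. -/
noncomputable def amin (σ : Equiv.Perm (Fin n)) : ℕ :=
  Nat.card {i : Fin n // IsLda σ i ∧ ∀ j, i ≤ j → σ i ≤ σ j}

/-- Number of aftermaxima: double descents (convention `∞`–`0`) that are right-to-left maxima. -/
noncomputable def amax (σ : Equiv.Perm (Fin n)) : ℕ :=
  Nat.card {i : Fin n // IsRdd σ i ∧ ∀ j, i ≤ j → σ j ≤ σ i}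

/-- Number of foreminima: double descents (convention `∞`–`0`) that are left-to-right minima. -/
noncomputable def fmin (σ : Equiv.Perm (Fin n)) : ℕ :=
  Nat.card {i : Fin n // IsRdd σ i ∧ ∀ j, j ≤ i → σ i ≤ σ j}

end Statistics

/-- The generalized `q`-Narayana polynomial `N_n(t, q, r)`. -/
noncomputable def narayana {K : Type*} [CommSemiring K] (n : ℕ) (t q r : K) : K :=
  ∑ σ ∈ avoiders n ![3, 2, 1], t ^ exc σ * q ^ inv σ * r ^ fix σ

/-- A pattern of length three together with three statistics on the permutations of `[m]`. -/
structure Choice (m : ℕ) where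
  τ : Fin 3 → ℕ
  stat₁ : Equiv.Perm (Fin m) → ℕ
  stat₂ : Equiv.Perm (Fin m) → ℕ
  stat₃ : Equiv.Perm (Fin m) → ℕ

/-- The five choices of a pattern and three statistics. -/
noncomputable def choices (m : ℕ) : List (Choice m) :=
  [⟨![3, 2, 1], exc, inv, fix⟩,
   ⟨![2, 3, 1], des, fun σ => des σ + vinc31_2 σ, fmax⟩,
   ⟨![1, 3, 2], asc, fun σ => asc σ + vinc2_13 σ, amax⟩,
   ⟨![3, 1, 2], des, fun σ => des σ + vinc2_31 σ, amin⟩,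
   ⟨![2, 1, 3], asc, fun σ => asc σ + vinc13_2 σ, fmin⟩]

end QNarayana

/-! All five sums are coefficients of one power series `desSeries t q r`, and both identities then
become identities between specialisations of that series.

A `231`-avoider is its first letter, followed by a `231`-avoider on the smaller letters, followed by
one on the larger letters (`join`). The statistics `des`, `31-2` and `fmax` are almost additive; the
only non-local correction is `gtFirst` of the middle block. Tracking it by an auxiliary series and
eliminating that series gives `desSeries_mul`. Writing F(r; x) for `desSeries t q r`, it says F(r;
x) (1 - r x - t q x² F(1+t; q x)) = 1. Iterated, this is a continued fraction, so F(r; x) also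
counts weighted Motzkin paths (`coeff_pathSeries`). A `321`-avoider is encoded by such a path
through its excedance positions and excedance values, with `inv` as the sum of heights and `fix` as
the number of uncoloured level steps on the ground (`narayana_eq_pathSum`). Reversal and complement
carry the remaining three patterns to `231`.

For the two identities, strip the constant term and one factor x from F at (t/q, q, 1), respectively
t x from F at (t, q, t). The remaining series V satisfies, in the second case after x is replaced by
x/t, the functional equation of the series on the right. That equation has only one solution
(`eq_of_functional_equation`), which gives `desSeries_div_one` and `desSeries_self`; comparing
coefficients finishes the proof. -/

namespace QNarayana

/-! ### Permutations as words indexed by natural numbers; statistics as finite sums -/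

section Words

variable {n : ℕ}

/-- The (zero-based) word of a permutation, extended by zeros. -/
def word (σ : Equiv.Perm (Fin n)) (i : ℕ) : ℕ := if h : i < n then (σ ⟨i, h⟩).val else 0

lemma word_of_lt (σ : Equiv.Perm (Fin n)) {i : ℕ} (h : i < n) : word σ i = (σ ⟨i, h⟩).val :=
  dif_pos h

lemma word_val (σ : Equiv.Perm (Fin n)) (i : Fin n) : word σ i.val = (σ i).val :=
  dif_pos i.isLt

lemma word_lt (σ : Equiv.Perm (Fin n)) {i : ℕ} (h : i < n) : word σ i < n := by
  rw [word_of_lt σ h]; exact (σ _).isLt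

lemma word_injOn (σ : Equiv.Perm (Fin n)) {i j : ℕ} (hi : i < n) (hj : j < n)
    (h : word σ i = word σ j) : i = j := by
  rw [word_of_lt σ hi, word_of_lt σ hj] at h
  simpa using σ.injective (Fin.ext h)

lemma natCard_fin_eq_sum (P : Fin n → Prop) (p : ℕ → Prop) [DecidablePred p]
    (h : ∀ i : Fin n, P i ↔ p i.val) :
    Nat.card {i // P i} = ∑ i ∈ Finset.range n, if p i then 1 else 0 := by
  classical
  rw [Nat.card_eq_fintype_card, Fintype.card_subtype, Finset.card_filter,
    ← Fin.sum_univ_eq_sum_range (fun i => if p i then 1 else 0)]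
  simp only [h]

lemma natCard_fin_prod_eq_sum (P : Fin n × Fin n → Prop) (p : ℕ → ℕ → Prop)
    [∀ i j, Decidable (p i j)] (h : ∀ i j : Fin n, P (i, j) ↔ p i.val j.val) :
    Nat.card {x // P x} =
      ∑ i ∈ Finset.range n, ∑ j ∈ Finset.range n, if p i j then 1 else 0 := by
  classical
  rw [Nat.card_eq_fintype_card, Fintype.card_subtype, Finset.card_filter,
    Fintype.sum_prod_type,
    ← Fin.sum_univ_eq_sum_range (fun i => ∑ j ∈ Finset.range n, if p i j then 1 else 0)]
  refine Finset.sum_congr rfl fun i _ => ?_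
  rw [← Fin.sum_univ_eq_sum_range (fun j => if p i.val j then 1 else 0)]
  simp only [h]

lemma des_eq_sum (σ : Equiv.Perm (Fin n)) :
    des σ = ∑ i ∈ Finset.range n, if i + 1 < n ∧ word σ (i + 1) < word σ i then 1 else 0 := by
  refine natCard_fin_eq_sum _ _ fun i => ?_
  rw [word_val, ← exists_prop]
  refine exists_congr fun h => ?_
  rw [word_of_lt σ h, Fin.lt_def]

lemma asc_eq_sum (σ : Equiv.Perm (Fin n)) :
    asc σ = ∑ i ∈ Finset.range n, if i + 1 < n ∧ word σ i < word σ (i + 1) then 1 else 0 := by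
  refine natCard_fin_eq_sum _ _ fun i => ?_
  rw [word_val, ← exists_prop]
  refine exists_congr fun h => ?_
  rw [word_of_lt σ h, Fin.lt_def]

lemma vinc31_2_eq_sum (σ : Equiv.Perm (Fin n)) :
    vinc31_2 σ = ∑ i ∈ Finset.range n, ∑ j ∈ Finset.range n,
      if i + 1 < n ∧ i + 1 < j ∧ word σ (i + 1) < word σ j ∧ word σ j < word σ i
      then 1 else 0 := by
  refine natCard_fin_prod_eq_sum _ _ fun i j => ?_
  rw [word_val, word_val, ← exists_prop]
  refine exists_congr fun h => ?_
  rw [word_of_lt σ h, Fin.lt_def, Fin.lt_def]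

lemma vinc2_31_eq_sum (σ : Equiv.Perm (Fin n)) :
    vinc2_31 σ = ∑ i ∈ Finset.range n, ∑ j ∈ Finset.range n,
      if i + 1 < n ∧ j < i ∧ word σ (i + 1) < word σ j ∧ word σ j < word σ i
      then 1 else 0 := by
  refine natCard_fin_prod_eq_sum _ _ fun i j => ?_
  rw [word_val, word_val, ← exists_prop]
  refine exists_congr fun h => ?_
  rw [word_of_lt σ h, Fin.lt_def, Fin.lt_def, Fin.lt_def]

lemma vinc2_13_eq_sum (σ : Equiv.Perm (Fin n)) :
    vinc2_13 σ = ∑ i ∈ Finset.range n, ∑ j ∈ Finset.range n,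
      if i + 1 < n ∧ j < i ∧ word σ i < word σ j ∧ word σ j < word σ (i + 1)
      then 1 else 0 := by
  refine natCard_fin_prod_eq_sum _ _ fun i j => ?_
  rw [word_val, word_val, ← exists_prop]
  refine exists_congr fun h => ?_
  rw [word_of_lt σ h, Fin.lt_def, Fin.lt_def, Fin.lt_def]

lemma vinc13_2_eq_sum (σ : Equiv.Perm (Fin n)) :
    vinc13_2 σ = ∑ i ∈ Finset.range n, ∑ j ∈ Finset.range n,
      if i + 1 < n ∧ i + 1 < j ∧ word σ i < word σ j ∧ word σ j < word σ (i + 1)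
      then 1 else 0 := by
  refine natCard_fin_prod_eq_sum _ _ fun i j => ?_
  rw [word_val, word_val, ← exists_prop]
  refine exists_congr fun h => ?_
  rw [word_of_lt σ h, Fin.lt_def, Fin.lt_def]

lemma letter_zero (a b : ℕ∞) (σ : Equiv.Perm (Fin n)) : letter a b σ 0 = a := rfl

lemma letter_succ_of_lt (a b : ℕ∞) (σ : Equiv.Perm (Fin n)) {m : ℕ} (h : m < n) :
    letter a b σ (m + 1) = ((word σ m + 1 : ℕ) : ℕ∞) := by
  simp [letter, h, word_of_lt]

lemma letter_succ_of_le (a b : ℕ∞) (σ : Equiv.Perm (Fin n)) {m : ℕ} (h : n ≤ m) :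
    letter a b σ (m + 1) = b := by
  simp [letter, h.not_gt]

lemma isLda_iff (σ : Equiv.Perm (Fin n)) (i : Fin n) :
    IsLda σ i ↔ (0 < i.val → word σ (i.val - 1) < word σ i.val) ∧
      (i.val + 1 < n → word σ i.val < word σ (i.val + 1)) := by
  obtain ⟨i, hi⟩ := i
  unfold IsLda
  refine and_congr ?_ ?_
  · rw [letter_succ_of_lt _ _ _ hi]
    cases i with
    | zero => simp [letter_zero]
    | succ m =>
      rw [letter_succ_of_lt _ _ _ (by omega), Nat.cast_lt]
      simp
  · simp only
    rw [letter_succ_of_lt _ _ _ hi]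
    by_cases h : i + 1 < n
    · rw [letter_succ_of_lt _ _ _ h, Nat.cast_lt]
      simp [h]
    · rw [letter_succ_of_le _ _ _ (by omega)]
      simp only [h, false_imp_iff, iff_true]
      exact ENat.natCast_lt_top _

lemma isRdd_iff (σ : Equiv.Perm (Fin n)) (i : Fin n) :
    IsRdd σ i ↔ (0 < i.val → word σ i.val < word σ (i.val - 1)) ∧
      (i.val + 1 < n → word σ (i.val + 1) < word σ i.val) := by
  obtain ⟨i, hi⟩ := i
  unfold IsRdd
  refine and_congr ?_ ?_
  · rw [letter_succ_of_lt _ _ _ hi]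
    cases i with
    | zero =>
      simp only [letter_zero, lt_self_iff_false, false_imp_iff, iff_true]
      exact ENat.natCast_lt_top _
    | succ m =>
      rw [letter_succ_of_lt _ _ _ (by omega), Nat.cast_lt]
      simp
  · simp only
    rw [letter_succ_of_lt _ _ _ hi]
    by_cases h : i + 1 < n
    · rw [letter_succ_of_lt _ _ _ h, Nat.cast_lt]
      simp [h]
    · rw [letter_succ_of_le _ _ _ (by omega)]
      simp [h]

lemma forall_fin_iff_forall_lt {P : Fin n → Prop} {p : ℕ → Prop} (h : ∀ i : Fin n, P i ↔ p i.val) :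
    (∀ i, P i) ↔ ∀ i < n, p i :=
  ⟨fun H i hi => (h ⟨i, hi⟩).1 (H _), fun H i => (h i).2 (H _ i.isLt)⟩

/-- A left-to-right maximum exceeds its predecessor automatically, so only the double-ascent
condition on the successor survives. The other three boundary statistics drop one of their two
neighbour conditions for the same reason. -/
lemma fmax_eq_sum (σ : Equiv.Perm (Fin n)) :
    fmax σ = ∑ i ∈ Finset.range n,
      if (i + 1 < n → word σ i < word σ (i + 1)) ∧ ∀ j < n, j ≤ i → word σ j ≤ word σ i
      then 1 else 0 := by
  refine natCard_fin_eq_sum _ _ fun i => ?_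
  rw [isLda_iff, forall_fin_iff_forall_lt (p := fun j => j ≤ i.val → word σ j ≤ word σ i.val)
    (fun j => by rw [word_val, word_val, Fin.le_def, Fin.le_def])]
  refine ⟨fun h => ⟨h.1.2, h.2⟩, fun h => ⟨⟨fun h0 => ?_, h.1⟩, h.2⟩⟩
  refine lt_of_le_of_ne (h.2 _ (by omega) (by omega)) fun he => ?_
  have := word_injOn σ (by omega) i.isLt he
  omega

lemma amin_eq_sum (σ : Equiv.Perm (Fin n)) :
    amin σ = ∑ i ∈ Finset.range n,
      if (0 < i → word σ (i - 1) < word σ i) ∧ ∀ j < n, i ≤ j → word σ i ≤ word σ j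
      then 1 else 0 := by
  refine natCard_fin_eq_sum _ _ fun i => ?_
  rw [isLda_iff, forall_fin_iff_forall_lt (p := fun j => i.val ≤ j → word σ i.val ≤ word σ j)
    (fun j => by rw [word_val, word_val, Fin.le_def, Fin.le_def])]
  refine ⟨fun h => ⟨h.1.1, h.2⟩, fun h => ⟨⟨h.1, fun h0 => ?_⟩, h.2⟩⟩
  refine lt_of_le_of_ne (h.2 _ (by omega) (by omega)) fun he => ?_
  have := word_injOn σ (by omega) (by omega) he
  omega

lemma amax_eq_sum (σ : Equiv.Perm (Fin n)) :
    amax σ = ∑ i ∈ Finset.range n,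
      if (0 < i → word σ i < word σ (i - 1)) ∧ ∀ j < n, i ≤ j → word σ j ≤ word σ i
      then 1 else 0 := by
  refine natCard_fin_eq_sum _ _ fun i => ?_
  rw [isRdd_iff, forall_fin_iff_forall_lt (p := fun j => i.val ≤ j → word σ j ≤ word σ i.val)
    (fun j => by rw [word_val, word_val, Fin.le_def, Fin.le_def])]
  refine ⟨fun h => ⟨h.1.1, h.2⟩, fun h => ⟨⟨h.1, fun h0 => ?_⟩, h.2⟩⟩
  refine lt_of_le_of_ne (h.2 _ (by omega) (by omega)) fun he => ?_
  have := word_injOn σ (by omega) (by omega) he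
  omega

lemma fmin_eq_sum (σ : Equiv.Perm (Fin n)) :
    fmin σ = ∑ i ∈ Finset.range n,
      if (i + 1 < n → word σ (i + 1) < word σ i) ∧ ∀ j < n, j ≤ i → word σ i ≤ word σ j
      then 1 else 0 := by
  refine natCard_fin_eq_sum _ _ fun i => ?_
  rw [isRdd_iff, forall_fin_iff_forall_lt (p := fun j => j ≤ i.val → word σ i.val ≤ word σ j)
    (fun j => by rw [word_val, word_val, Fin.le_def, Fin.le_def])]
  refine ⟨fun h => ⟨h.1.2, h.2⟩, fun h => ⟨⟨fun h0 => ?_, h.1⟩, h.2⟩⟩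
  refine lt_of_le_of_ne (h.2 _ (by omega) (by omega)) fun he => ?_
  have := word_injOn σ i.isLt (by omega) he
  omega

lemma contains_iff (σ : Equiv.Perm (Fin n)) (τ : Fin 3 → ℕ) :
    Contains σ τ ↔ ∃ i j k : Fin n, i < j ∧ j < k ∧
      ((σ i < σ j ↔ τ 0 < τ 1) ∧ (σ i < σ k ↔ τ 0 < τ 2) ∧ (σ j < σ k ↔ τ 1 < τ 2) ∧
       (σ j < σ i ↔ τ 1 < τ 0) ∧ (σ k < σ i ↔ τ 2 < τ 0) ∧ (σ k < σ j ↔ τ 2 < τ 1)) := by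
  constructor
  · rintro ⟨f, hf, h⟩
    exact ⟨f 0, f 1, f 2, hf (by decide), hf (by decide), h 0 1, h 0 2, h 1 2, h 1 0, h 2 0, h 2 1⟩
  · rintro ⟨i, j, k, hij, hjk, h01, h02, h12, h10, h20, h21⟩
    refine ⟨![i, j, k], ?_, ?_⟩
    · intro a b hab
      fin_cases a <;> fin_cases b <;> simp at hab ⊢ <;>
        first | assumption | exact hij.trans hjk
    · intro a b
      fin_cases a <;> fin_cases b <;> simp <;> assumption

lemma mem_avoiders {k : ℕ} (σ : Equiv.Perm (Fin n)) (τ : Fin k → ℕ) :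
    σ ∈ avoiders n τ ↔ ¬ Contains σ τ := by
  classical
  simp [avoiders]

lemma mem_avoiders_321 (σ : Equiv.Perm (Fin n)) :
    σ ∈ avoiders n ![3, 2, 1] ↔ ∀ i j k : Fin n, i < j → j < k → ¬ (σ j < σ i ∧ σ k < σ j) := by
  rw [mem_avoiders, contains_iff]
  simp
  grind

lemma mem_avoiders_231 (σ : Equiv.Perm (Fin n)) :
    σ ∈ avoiders n ![2, 3, 1] ↔ ∀ i j k : Fin n, i < j → j < k → ¬ (σ i < σ j ∧ σ k < σ i) := by
  rw [mem_avoiders, contains_iff]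
  simp
  grind

end Words

end QNarayana

/-! ### Decomposition of `231`-avoiders at the first letter -/

namespace QNarayana

/-- The permutation whose first letter is the maximum, followed by the letters of `σ`. -/
def prependMax {a : ℕ} (σ : Equiv.Perm (Fin a)) : Equiv.Perm (Fin (a + 1)) :=
  (finSuccEquiv a).trans ((Equiv.optionCongr σ).trans finSuccEquivLast.symm)

lemma prependMax_zero {a : ℕ} (σ : Equiv.Perm (Fin a)) : prependMax σ 0 = Fin.last a := by
  simp [prependMax]

lemma prependMax_succ {a : ℕ} (σ : Equiv.Perm (Fin a)) (i : Fin a) :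
    prependMax σ i.succ = (σ i).castSucc := by
  simp [prependMax]

lemma exists_prependMax_eq {a : ℕ} (σ : Equiv.Perm (Fin (a + 1))) (h : σ 0 = Fin.last a) :
    ∃ ρ, prependMax ρ = σ := by
  refine ⟨Equiv.removeNone ((finSuccEquiv a).symm.trans (σ.trans finSuccEquivLast)), ?_⟩
  refine Equiv.ext fun i => ?_
  refine Fin.cases ?_ (fun i => ?_) i
  · rw [prependMax_zero, h]
  · rw [prependMax_succ, ← finSuccEquivLast_symm_some, Equiv.symm_apply_eq, Equiv.removeNone_some]
    · simp
    · have hne : σ i.succ ≠ Fin.last a := fun he =>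
        Fin.succ_ne_zero i (σ.injective (he.trans h.symm))
      obtain ⟨j, hj⟩ := Fin.exists_castSucc_eq.2 hne
      exact ⟨j, by simp [← hj]⟩

/-- The direct sum of two permutations. -/
def directSum {a b : ℕ} (σ : Equiv.Perm (Fin a)) (ρ : Equiv.Perm (Fin b)) :
    Equiv.Perm (Fin (a + b)) :=
  finSumFinEquiv.permCongr (Equiv.sumCongr σ ρ)

lemma directSum_castAdd {a b : ℕ} (σ : Equiv.Perm (Fin a)) (ρ : Equiv.Perm (Fin b)) (i : Fin a) :
    directSum σ ρ (i.castAdd b) = (σ i).castAdd b := by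
  simp [directSum, Equiv.permCongr_apply]

lemma directSum_natAdd {a b : ℕ} (σ : Equiv.Perm (Fin a)) (ρ : Equiv.Perm (Fin b)) (i : Fin b) :
    directSum σ ρ (i.natAdd a) = (ρ i).natAdd a := by
  simp [directSum, Equiv.permCongr_apply]

lemma exists_directSum_eq {a b : ℕ} (σ : Equiv.Perm (Fin (a + b)))
    (h : ∀ i, i.val < a → (σ i).val < a) : ∃ ρ₁ ρ₂, directSum (a := a) (b := b) ρ₁ ρ₂ = σ := by
  have hm : Set.MapsTo (finSumFinEquiv.symm.permCongr σ : Equiv.Perm (Fin a ⊕ Fin b))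
      (Set.range Sum.inl) (Set.range Sum.inl) := by
    rintro _ ⟨i, rfl⟩
    have := h (i.castAdd b) (by simp)
    refine ⟨⟨_, this⟩, ?_⟩
    rw [Equiv.permCongr_apply, Equiv.symm_symm, finSumFinEquiv_apply_left, Equiv.eq_symm_apply,
      finSumFinEquiv_apply_left]
    rfl
  obtain ⟨⟨ρ₁, ρ₂⟩, hρ⟩ := Equiv.Perm.mem_sumCongrHom_range_of_perm_mapsTo_inl hm
  refine ⟨ρ₁, ρ₂, ?_⟩
  rw [Equiv.Perm.sumCongrHom_apply] at hρ
  change finSumFinEquiv.permCongr (Equiv.Perm.sumCongr ρ₁ ρ₂) = σ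
  rw [hρ]
  ext i
  simp [Equiv.permCongr_apply]

/-- The permutation with first letter `a` (zero-based), then the letters of `σ`, then the letters
of `ρ` shifted above `a`. -/
def join {a b : ℕ} (σ : Equiv.Perm (Fin a)) (ρ : Equiv.Perm (Fin b)) :
    Equiv.Perm (Fin (a + 1 + b)) :=
  directSum (prependMax σ) ρ

section Join

variable {a b : ℕ} (σ : Equiv.Perm (Fin a)) (ρ : Equiv.Perm (Fin b))

lemma word_join_zero : word (join σ ρ) 0 = a := by
  have h := directSum_castAdd (prependMax σ) ρ 0
  rw [prependMax_zero] at h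
  have h2 := word_val (join σ ρ) (Fin.castAdd b 0)
  rw [join, h, ← join] at h2
  simpa using h2

lemma word_join_succ {i : ℕ} (hi : i < a) : word (join σ ρ) (i + 1) = word σ i := by
  have h := directSum_castAdd (prependMax σ) ρ (Fin.succ ⟨i, hi⟩)
  rw [prependMax_succ] at h
  have h2 := word_val (join σ ρ) (Fin.castAdd b (Fin.succ ⟨i, hi⟩))
  rw [join, h, ← join] at h2
  rw [word_of_lt σ hi]
  simpa using h2

lemma word_join_add {i : ℕ} (hi : i < b) :
    word (join σ ρ) (a + 1 + i) = a + 1 + word ρ i := by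
  have h := directSum_natAdd (prependMax σ) ρ ⟨i, hi⟩
  have h2 := word_val (join σ ρ) (Fin.natAdd (a + 1) ⟨i, hi⟩)
  rw [join, h, ← join] at h2
  rw [word_of_lt ρ hi]
  simpa using h2

lemma word_ext {n : ℕ} {σ ρ : Equiv.Perm (Fin n)} (h : ∀ i < n, word σ i = word ρ i) : σ = ρ := by
  ext i
  rw [← word_val, ← word_val, h _ i.isLt]

lemma mem_avoiders_231_iff_word {n : ℕ} (σ : Equiv.Perm (Fin n)) :
    σ ∈ avoiders n ![2, 3, 1] ↔ ∀ i j k, i < j → j < k → k < n →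
      ¬ (word σ i < word σ j ∧ word σ k < word σ i) := by
  rw [mem_avoiders_231]
  constructor
  · intro h i j k hij hjk hk
    have := h ⟨i, by omega⟩ ⟨j, by omega⟩ ⟨k, hk⟩ hij hjk
    rwa [Fin.lt_def, Fin.lt_def, ← word_of_lt, ← word_of_lt, ← word_of_lt] at this
  · intro h i j k hij hjk
    have := h i j k hij hjk k.isLt
    rwa [word_val, word_val, word_val] at this

/-- The first `a + 1` positions carry exactly the letters up to `a`. A `231` whose last position
lies beyond them must start beyond them too, since its last letter is its smallest; otherwise it
lies among the first `a + 1` positions, where it cannot begin with their maximum. -/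
lemma join_mem_avoiders_iff :
    join σ ρ ∈ avoiders (a + 1 + b) ![2, 3, 1] ↔
      σ ∈ avoiders a ![2, 3, 1] ∧ ρ ∈ avoiders b ![2, 3, 1] := by
  simp only [mem_avoiders_231_iff_word]
  constructor
  · intro h
    refine ⟨fun i j k hij hjk hk => ?_, fun i j k hij hjk hk => ?_⟩
    · have := h (i + 1) (j + 1) (k + 1) (by omega) (by omega) (by omega)
      rwa [word_join_succ _ _ (by omega), word_join_succ _ _ (by omega),
        word_join_succ _ _ (by omega)] at this
    · have := h (a + 1 + i) (a + 1 + j) (a + 1 + k) (by omega) (by omega) (by omega)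
      rwa [word_join_add _ _ (by omega), word_join_add _ _ (by omega),
        word_join_add _ _ (by omega), Nat.add_lt_add_iff_left, Nat.add_lt_add_iff_left] at this
  · rintro ⟨h1, h2⟩ i j k hij hjk hk ⟨hv1, hv2⟩
    have key : ∀ x < a + 1 + b, (x < a + 1 → word (join σ ρ) x < a + 1) ∧
        (a + 1 ≤ x → a + 1 ≤ word (join σ ρ) x) := by
      intro x hx
      refine ⟨fun h => ?_, fun h => ?_⟩
      · rcases x with _ | x
        · rw [word_join_zero]; omega
        · rw [word_join_succ _ _ (by omega)]
          have := word_lt σ (i := x) (by omega)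
          omega
      · obtain ⟨y, rfl⟩ := Nat.exists_eq_add_of_le h
        rw [word_join_add _ _ (by omega)]
        omega
    have ki := key i (by omega)
    have kk := key k (by omega)
    by_cases hka : k < a + 1
    · obtain ⟨j, rfl⟩ : ∃ j', j = j' + 1 := ⟨j - 1, by omega⟩
      obtain ⟨k, rfl⟩ : ∃ k', k = k' + 1 := ⟨k - 1, by omega⟩
      rw [word_join_succ _ _ (by omega)] at hv1 hv2
      rcases i with _ | i
      · rw [word_join_zero] at hv1
        have := word_lt σ (i := j) (by omega)
        omega
      · rw [word_join_succ _ _ (by omega)] at hv1 hv2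
        exact h1 i j k (by omega) (by omega) (by omega) ⟨hv1, hv2⟩
    · have hia : a + 1 ≤ i := by
        by_contra hc
        have := ki.1 (by omega)
        have := kk.2 (by omega)
        omega
      obtain ⟨i, rfl⟩ := Nat.exists_eq_add_of_le hia
      obtain ⟨j, rfl⟩ := Nat.exists_eq_add_of_le (show a + 1 ≤ j by omega)
      obtain ⟨k, rfl⟩ := Nat.exists_eq_add_of_le (show a + 1 ≤ k by omega)
      rw [word_join_add _ _ (by omega), word_join_add _ _ (by omega)] at hv1 hv2
      exact h2 i j k (by omega) (by omega) (by omega) ⟨by omega, by omega⟩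

lemma join_injective {σ σ' : Equiv.Perm (Fin a)} {ρ ρ' : Equiv.Perm (Fin b)}
    (h : join σ ρ = join σ' ρ') : σ = σ' ∧ ρ = ρ' := by
  refine ⟨word_ext fun i hi => ?_, word_ext fun i hi => ?_⟩
  · rw [← word_join_succ σ ρ hi, h, word_join_succ _ _ hi]
  · have := word_join_add σ ρ hi
    rw [h, word_join_add _ _ hi] at this
    omega

lemma exists_join_eq (π : Equiv.Perm (Fin (a + 1 + b))) (hπ : π ∈ avoiders _ ![2, 3, 1])
    (h0 : word π 0 = a) : ∃ (σ : Equiv.Perm (Fin a)) (ρ : Equiv.Perm (Fin b)), join σ ρ = π := by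
  rw [mem_avoiders_231] at hπ
  have hz : (π ⟨0, by omega⟩).val = a := by rw [← word_of_lt]; exact h0
  have hlow : ∀ i, i.val < a + 1 → (π i).val < a + 1 := by
    by_contra! hc
    obtain ⟨p, hp, hpa⟩ := hc
    -- If an early position `p` carries a letter above `a`, then a letter below `a` at a late
    -- position `r` would complete a `231` with positions `0` and `p`. So the late positions are
    -- stable under `π`, hence by finiteness under its inverse, which contradicts the choice of `p`.
    have hup : Set.MapsTo π {i | a + 1 ≤ i.val} {i | a + 1 ≤ i.val} := by
      intro r hr
      simp only [Set.mem_ofPred_eq] at hr ⊢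
      by_contra hc
      refine hπ ⟨0, by omega⟩ p r ?_ ?_ ⟨?_, ?_⟩
      · rw [Fin.lt_def]
        rcases Nat.eq_zero_or_pos p.val with h | h
        · have : p = ⟨0, by omega⟩ := Fin.ext h
          rw [this] at hpa; omega
        · exact h
      · rw [Fin.lt_def]; omega
      · rw [Fin.lt_def]; omega
      · rw [Fin.lt_def]
        have : π r ≠ π ⟨0, by omega⟩ := fun he => by
          have := congrArg Fin.val (π.injective he)
          simp only at this; omega
        rw [Ne, Fin.ext_iff] at this
        omega
    have := Equiv.Perm.perm_symm_mapsTo_of_mapsTo π hup hpa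
    simp at this
    omega
  obtain ⟨σ', ρ, rfl⟩ := exists_directSum_eq π hlow
  obtain ⟨σ, rfl⟩ := exists_prependMax_eq σ' (by
    have := directSum_castAdd σ' ρ 0
    rw [show Fin.castAdd b (0 : Fin (a + 1)) = ⟨0, by omega⟩ from rfl] at this
    rw [this] at hz
    exact Fin.ext hz)
  exact ⟨σ, ρ, rfl⟩

end Join

lemma sum_avoiders_first_letter {K : Type*} [AddCommMonoid K]
    (f : (m : ℕ) → Equiv.Perm (Fin m) → K) {a b m : ℕ} (hm : m = a + 1 + b) :
    ∑ π ∈ avoiders m ![2, 3, 1] with word π 0 = a, f m π =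
      ∑ σ ∈ avoiders a ![2, 3, 1], ∑ ρ ∈ avoiders b ![2, 3, 1], f (a + 1 + b) (join σ ρ) := by
  subst hm
  rw [← Finset.sum_product']
  symm
  refine Finset.sum_nbij (fun x => join x.1 x.2) ?_ ?_ ?_ fun _ _ => rfl
  · intro x hx
    rw [Finset.mem_product] at hx
    rw [Finset.mem_filter, join_mem_avoiders_iff]
    exact ⟨hx, word_join_zero _ _⟩
  · rintro ⟨σ, ρ⟩ _ ⟨σ', ρ'⟩ _ h
    exact Prod.ext (join_injective h).1 (join_injective h).2
  · intro π hπ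
    rw [Finset.mem_coe, Finset.mem_filter] at hπ
    obtain ⟨σ, ρ, rfl⟩ := exists_join_eq π hπ.1 hπ.2
    refine ⟨(σ, ρ), ?_, rfl⟩
    rw [Finset.mem_coe, Finset.mem_product]
    exact (join_mem_avoiders_iff σ ρ).1 hπ.1

lemma sum_avoiders_succ {K : Type*} [AddCommMonoid K]
    (f : (m : ℕ) → Equiv.Perm (Fin m) → K) (n : ℕ) :
    ∑ π ∈ avoiders (n + 1) ![2, 3, 1], f (n + 1) π =
      ∑ x ∈ Finset.HasAntidiagonal.antidiagonal n, ∑ σ ∈ avoiders x.1 ![2, 3, 1],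
        ∑ ρ ∈ avoiders x.2 ![2, 3, 1], f (x.1 + 1 + x.2) (join σ ρ) := by
  rw [← Finset.sum_fiberwise_of_maps_to (s := avoiders (n + 1) ![2, 3, 1])
    (t := Finset.range (n + 1)) (g := fun π => word π 0)
    (fun π _ => Finset.mem_range.2 (word_lt π (Nat.succ_pos n)))]
  rw [← Finset.Nat.sum_antidiagonal_eq_sum_range_succ_mk (fun x =>
    ∑ π ∈ avoiders (n + 1) ![2, 3, 1] with word π 0 = x.1, f (n + 1) π)]
  refine Finset.sum_congr rfl fun x hx => ?_
  rw [Finset.HasAntidiagonal.mem_antidiagonal] at hx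
  exact sum_avoiders_first_letter f (by omega)

end QNarayana

namespace QNarayana

/-! ### Behaviour of the statistics under `join` -/

section JoinStatistics

variable {a b : ℕ} (σ : Equiv.Perm (Fin a)) (ρ : Equiv.Perm (Fin b))

/-- The number of letters larger than the first one. -/
def gtFirst {n : ℕ} (σ : Equiv.Perm (Fin n)) : ℕ :=
  ∑ j ∈ Finset.range n, if word σ 0 < word σ j then 1 else 0

lemma sum_range_join {M : Type*} [AddCommMonoid M] (f : ℕ → M) (a b : ℕ) :
    ∑ i ∈ Finset.range (a + 1 + b), f i =
      f 0 + ∑ i ∈ Finset.range a, f (i + 1) + ∑ i ∈ Finset.range b, f (a + 1 + i) := by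
  rw [Finset.sum_range_add, Finset.sum_range_succ', add_comm (f 0)]

lemma word_join_one_of_zero (h : a = 0) (hb : 0 < b) : word (join σ ρ) 1 = 1 + word ρ 0 := by
  have := word_join_add σ ρ hb
  subst h
  simpa using this

lemma word_join_last (hb : 0 < b) : word (join σ ρ) (a + 1) = a + 1 + word ρ 0 :=
  word_join_add σ ρ hb

/-- The passage into the block of `ρ` is always an ascent; the first letter starts a descent exactly
when the block of `σ` is nonempty. -/
lemma des_join : des (join σ ρ) = des σ + des ρ + if 0 < a then 1 else 0 := by
  have h0 : (if 0 + 1 < a + 1 + b ∧ word (join σ ρ) (0 + 1) < word (join σ ρ) 0 then 1 else 0)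
      = if 0 < a then 1 else 0 := by
    rw [word_join_zero]
    rcases Nat.eq_zero_or_pos a with h | h
    · rw [if_neg, if_neg (by omega)]
      rintro ⟨h1, h2⟩
      rw [zero_add, word_join_one_of_zero σ ρ h (by omega)] at h2
      omega
    · rw [word_join_succ σ ρ h, if_pos h, if_pos]
      exact ⟨by omega, word_lt σ h⟩
  rw [des_eq_sum, des_eq_sum, des_eq_sum, sum_range_join, h0]
  have h1 : ∀ i ∈ Finset.range a,
      (if i + 1 + 1 < a + 1 + b ∧ word (join σ ρ) (i + 1 + 1) < word (join σ ρ) (i + 1)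
        then 1 else 0) = if i + 1 < a ∧ word σ (i + 1) < word σ i then 1 else 0 := by
    intro i hi
    rw [Finset.mem_range] at hi
    rw [word_join_succ σ ρ hi]
    rcases Nat.lt_or_ge (i + 1) a with h | h
    · rw [word_join_succ σ ρ h]
      exact if_congr (by omega) rfl rfl
    · rw [if_neg, if_neg (by omega)]
      rintro ⟨h1, h2⟩
      obtain rfl : a = i + 1 := by omega
      rw [word_join_last σ ρ (by omega)] at h2
      have := word_lt σ hi
      omega
  have h2 : ∀ i ∈ Finset.range b,
      (if a + 1 + i + 1 < a + 1 + b ∧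
          word (join σ ρ) (a + 1 + i + 1) < word (join σ ρ) (a + 1 + i)
        then 1 else 0) = if i + 1 < b ∧ word ρ (i + 1) < word ρ i then 1 else 0 := by
    intro i hi
    rw [Finset.mem_range] at hi
    rw [word_join_add σ ρ hi]
    rcases Nat.lt_or_ge (i + 1) b with h | h
    · rw [add_assoc (a + 1) i 1, word_join_add σ ρ h]
      exact if_congr (by omega) rfl rfl
    · rw [if_neg (by omega), if_neg (by omega)]
  rw [Finset.sum_congr rfl h1, Finset.sum_congr rfl h2]
  omega

/-- The descent from `a` to the first letter of `σ` creates one new occurrence for each later letter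
strictly between the two, that is, for each letter of `σ` above its first. Letters of `ρ` are too
large to play the `2` for any earlier descent. -/
lemma vinc31_2_join : vinc31_2 (join σ ρ) = vinc31_2 σ + vinc31_2 ρ + gtFirst σ := by
  rw [vinc31_2_eq_sum, vinc31_2_eq_sum, vinc31_2_eq_sum, sum_range_join]
  have h0 : (∑ j ∈ Finset.range (a + 1 + b),
      if 0 + 1 < a + 1 + b ∧ 0 + 1 < j ∧ word (join σ ρ) (0 + 1) < word (join σ ρ) j ∧
        word (join σ ρ) j < word (join σ ρ) 0 then 1 else 0) = gtFirst σ := by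
    rw [sum_range_join, if_neg (by omega), zero_add, word_join_zero]
    rw [Finset.sum_eq_zero (s := Finset.range b), add_zero]
    · refine Finset.sum_congr rfl fun j hj => ?_
      rw [Finset.mem_range] at hj
      rw [word_join_succ σ ρ hj, word_join_succ σ ρ (by omega)]
      have := word_lt σ hj
      refine if_congr ⟨fun h => h.2.2.1, fun h => ⟨by omega, ?_, h, this⟩⟩ rfl rfl
      rcases Nat.eq_zero_or_pos j with rfl | hj
      · omega
      · omega
    · intro j hj
      rw [Finset.mem_range] at hj
      rw [word_join_add σ ρ hj, if_neg (by omega)]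
  have h1 : ∀ i ∈ Finset.range a, (∑ j ∈ Finset.range (a + 1 + b),
      if i + 1 + 1 < a + 1 + b ∧ i + 1 + 1 < j ∧
        word (join σ ρ) (i + 1 + 1) < word (join σ ρ) j ∧
        word (join σ ρ) j < word (join σ ρ) (i + 1) then 1 else 0) =
      ∑ j ∈ Finset.range a, if i + 1 < a ∧ i + 1 < j ∧ word σ (i + 1) < word σ j ∧
        word σ j < word σ i then 1 else 0 := by
    intro i hi
    rw [Finset.mem_range] at hi
    have hlt := word_lt σ hi
    rw [sum_range_join, if_neg (by omega), zero_add, word_join_succ σ ρ hi]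
    rw [Finset.sum_eq_zero (s := Finset.range b), add_zero]
    · refine Finset.sum_congr rfl fun j hj => ?_
      rw [Finset.mem_range] at hj
      rw [word_join_succ σ ρ hj]
      rcases Nat.lt_or_ge (i + 1) a with h | h
      · rw [word_join_succ σ ρ h]
        exact if_congr (by omega) rfl rfl
      · rw [if_neg (by omega), if_neg (by omega)]
    · intro j hj
      rw [Finset.mem_range] at hj
      rw [word_join_add σ ρ hj, if_neg (by omega)]
  have h2 : ∀ i ∈ Finset.range b, (∑ j ∈ Finset.range (a + 1 + b),
      if a + 1 + i + 1 < a + 1 + b ∧ a + 1 + i + 1 < j ∧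
        word (join σ ρ) (a + 1 + i + 1) < word (join σ ρ) j ∧
        word (join σ ρ) j < word (join σ ρ) (a + 1 + i) then 1 else 0) =
      ∑ j ∈ Finset.range b, if i + 1 < b ∧ i + 1 < j ∧ word ρ (i + 1) < word ρ j ∧
        word ρ j < word ρ i then 1 else 0 := by
    intro i hi
    rw [Finset.mem_range] at hi
    rw [sum_range_join, if_neg (by omega), zero_add, word_join_add σ ρ hi]
    rw [Finset.sum_eq_zero (s := Finset.range a), zero_add]
    · refine Finset.sum_congr rfl fun j hj => ?_
      rw [Finset.mem_range] at hj
      rw [word_join_add σ ρ hj]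
      rcases Nat.lt_or_ge (i + 1) b with h | h
      · rw [add_assoc (a + 1) i 1, word_join_add σ ρ h]
        exact if_congr (by omega) rfl rfl
      · rw [if_neg (by omega), if_neg (by omega)]
    · intro j hj
      rw [Finset.mem_range] at hj
      rw [if_neg (by omega)]
  rw [Finset.sum_congr rfl h1, Finset.sum_congr rfl h2, h0]
  omega

lemma gtFirst_join : gtFirst (join σ ρ) = b := by
  rw [gtFirst, sum_range_join, if_neg (lt_irrefl _), word_join_zero, zero_add,
    Finset.sum_eq_zero, zero_add]
  · rw [Finset.sum_congr rfl (g := fun _ => 1), Finset.sum_const, Finset.card_range, smul_eq_mul,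
      mul_one]
    intro j hj
    rw [Finset.mem_range] at hj
    rw [word_join_add σ ρ hj, if_pos (by omega)]
  · intro j hj
    rw [Finset.mem_range] at hj
    have := word_lt σ hj
    rw [word_join_succ σ ρ hj, if_neg (by omega)]

/-- No letter of `σ` is a left-to-right maximum, being preceded by `a`. The first letter is one, and
it is followed by an ascent or by the end of the word exactly when `σ` is empty. -/
lemma fmax_join : fmax (join σ ρ) = fmax ρ + if a = 0 then 1 else 0 := by
  rw [fmax_eq_sum, fmax_eq_sum, sum_range_join]
  have h0 : (if (0 + 1 < a + 1 + b → word (join σ ρ) 0 < word (join σ ρ) (0 + 1)) ∧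
      ∀ j < a + 1 + b, j ≤ 0 → word (join σ ρ) j ≤ word (join σ ρ) 0 then 1 else 0) =
      if a = 0 then 1 else 0 := by
    refine if_congr ⟨fun h => ?_, fun h => ⟨fun hb => ?_, fun j _ hj => ?_⟩⟩ rfl rfl
    · by_contra hc
      have h1 := h.1 (by omega)
      rw [word_join_zero, word_join_succ σ ρ (by omega)] at h1
      have := word_lt σ (i := 0) (by omega)
      omega
    · rw [word_join_zero, zero_add, word_join_one_of_zero σ ρ h (by omega)]
      omega
    · rw [Nat.le_zero.1 hj]
  have h1 : ∀ i ∈ Finset.range a,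
      (if (i + 1 + 1 < a + 1 + b → word (join σ ρ) (i + 1) < word (join σ ρ) (i + 1 + 1)) ∧
        ∀ j < a + 1 + b, j ≤ i + 1 → word (join σ ρ) j ≤ word (join σ ρ) (i + 1)
        then 1 else 0) = 0 := by
    intro i hi
    rw [Finset.mem_range] at hi
    refine if_neg fun h => ?_
    have := h.2 0 (by omega) (by omega)
    rw [word_join_zero, word_join_succ σ ρ hi] at this
    have := word_lt σ hi
    omega
  have h2 : ∀ i ∈ Finset.range b,
      (if (a + 1 + i + 1 < a + 1 + b →
          word (join σ ρ) (a + 1 + i) < word (join σ ρ) (a + 1 + i + 1)) ∧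
        ∀ j < a + 1 + b, j ≤ a + 1 + i → word (join σ ρ) j ≤ word (join σ ρ) (a + 1 + i)
        then 1 else 0) =
      if (i + 1 < b → word ρ i < word ρ (i + 1)) ∧ ∀ j < b, j ≤ i → word ρ j ≤ word ρ i
        then 1 else 0 := by
    intro i hi
    rw [Finset.mem_range] at hi
    rw [word_join_add σ ρ hi]
    refine if_congr (and_congr ⟨fun h hb => ?_, fun h hb => ?_⟩
      ⟨fun h j hj hji => ?_, fun h j hj hji => ?_⟩) rfl rfl
    · have := h (by omega)
      rw [add_assoc (a + 1) i 1, word_join_add σ ρ hb] at this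
      omega
    · have := h (by omega)
      rw [add_assoc (a + 1) i 1, word_join_add σ ρ (by omega)]
      omega
    · have := h (a + 1 + j) (by omega) (by omega)
      rw [word_join_add σ ρ hj] at this
      omega
    · rcases Nat.lt_or_ge j (a + 1) with h' | h'
      · rcases j with _ | j
        · rw [word_join_zero]; omega
        · rw [word_join_succ σ ρ (by omega)]
          have := word_lt σ (i := j) (by omega)
          omega
      · obtain ⟨j, rfl⟩ := Nat.exists_eq_add_of_le h'
        have := h j (by omega) (by omega)
        rw [word_join_add σ ρ (by omega)]
        omega
  rw [Finset.sum_congr rfl h1, Finset.sum_congr rfl h2, h0, Finset.sum_const_zero]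
  omega

end JoinStatistics

/-! ### Generating functions and the continued fraction step -/

section Series

open PowerSeries

variable {K : Type*} [CommRing K]

/-- The generating function of `(des, des + 31-2, fmax)` on `231`-avoiding permutations. -/
noncomputable def desSeries (t q r : K) : K⟦X⟧ :=
  mk fun n => ∑ σ ∈ avoiders n ![2, 3, 1], t ^ des σ * q ^ (des σ + vinc31_2 σ) * r ^ fmax σ

/-- The generating function of `(des, des + 31-2 + gtFirst)` on `231`-avoiding permutations. -/
noncomputable def firstSeries (t q : K) : K⟦X⟧ :=
  mk fun n => ∑ σ ∈ avoiders n ![2, 3, 1],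
    t ^ des σ * q ^ (des σ + vinc31_2 σ) * q ^ gtFirst σ

lemma avoiders_zero {k : ℕ} (τ : Fin (k + 1) → ℕ) : avoiders 0 τ = {1} := by
  ext σ
  rw [mem_avoiders, Finset.mem_singleton]
  exact ⟨fun _ => Subsingleton.elim _ _, fun _ ⟨f, _⟩ => (f 0).elim0⟩

lemma coeff_zero_firstSeries (t q : K) : coeff 0 (firstSeries t q) = 1 := by
  rw [firstSeries, coeff_mk, avoiders_zero, Finset.sum_singleton]
  simp [des_eq_sum, vinc31_2_eq_sum, gtFirst]

lemma coeff_zero_desSeries (t q r : K) : coeff 0 (desSeries t q r) = 1 := by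
  rw [desSeries, coeff_mk, avoiders_zero, Finset.sum_singleton]
  simp [des_eq_sum, vinc31_2_eq_sum, fmax_eq_sum]

/-- This is the contribution of the first letter together with the block below it: `r` when the
block is empty, and otherwise one extra descent, worth `t * q`, and a factor `q` for each letter of
the block above its first. -/
lemma coeff_first_block (t q r : K) (a : ℕ) :
    coeff a (C r + C (t * q) * (firstSeries t q - 1)) =
      ∑ σ ∈ avoiders a ![2, 3, 1], t ^ (des σ + if 0 < a then 1 else 0) *
        q ^ ((des σ + if 0 < a then 1 else 0) + (vinc31_2 σ + gtFirst σ)) *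
        r ^ (if a = 0 then 1 else 0) := by
  rcases Nat.eq_zero_or_pos a with rfl | ha
  · rw [avoiders_zero, Finset.sum_singleton]
    simp only [map_add, map_sub, coeff_C_mul, coeff_zero_firstSeries]
    simp [des_eq_sum, vinc31_2_eq_sum, gtFirst]
  · rw [map_add, coeff_C_mul, map_sub, coeff_C, coeff_one, if_neg ha.ne', if_neg ha.ne', zero_add,
      sub_zero, firstSeries, coeff_mk, Finset.mul_sum]
    refine Finset.sum_congr rfl fun σ _ => ?_
    rw [if_pos ha, if_neg ha.ne']
    ring

lemma desSeries_eq (t q r : K) :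
    desSeries t q r =
      1 + X * ((C r + C (t * q) * (firstSeries t q - 1)) * desSeries t q r) := by
  ext n
  rcases n with _ | n
  · rw [map_add, coeff_zero_desSeries, coeff_zero_X_mul]
    simp
  · rw [map_add, coeff_succ_X_mul, coeff_mul, coeff_one, if_neg (Nat.succ_ne_zero n), zero_add]
    nth_rw 1 [desSeries]
    rw [coeff_mk, sum_avoiders_succ
      (fun m σ => t ^ des σ * q ^ (des σ + vinc31_2 σ) * r ^ fmax σ)]
    refine Finset.sum_congr rfl fun x _ => ?_
    rw [coeff_first_block, desSeries, coeff_mk, Finset.sum_mul_sum]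
    refine Finset.sum_congr rfl fun σ _ => Finset.sum_congr rfl fun ρ _ => ?_
    rw [des_join, vinc31_2_join, fmax_join]
    ring

lemma firstSeries_eq (t q : K) :
    firstSeries t q =
      1 + X * ((1 + C (t * q) * (firstSeries t q - 1)) * rescale q (desSeries t q 1)) := by
  ext n
  rcases n with _ | n
  · rw [map_add, coeff_zero_firstSeries, coeff_zero_X_mul]
    simp
  · rw [map_add, coeff_succ_X_mul, coeff_mul, coeff_one, if_neg (Nat.succ_ne_zero n), zero_add]
    nth_rw 1 [firstSeries]
    rw [coeff_mk, sum_avoiders_succ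
      (fun m σ => t ^ des σ * q ^ (des σ + vinc31_2 σ) * q ^ gtFirst σ)]
    refine Finset.sum_congr rfl fun x _ => ?_
    have hb := coeff_first_block t q 1 x.1
    rw [map_one] at hb
    rw [hb, coeff_rescale, desSeries, coeff_mk, Finset.mul_sum, Finset.sum_mul_sum]
    refine Finset.sum_congr rfl fun σ _ => Finset.sum_congr rfl fun ρ _ => ?_
    rw [des_join, vinc31_2_join, gtFirst_join]
    ring

lemma rescale_C_apply (a r : K) : rescale a (C r) = C r := by
  ext n
  rw [coeff_rescale, coeff_C]
  split_ifs with h <;> simp [h]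

/-- The continued fraction step expressing `desSeries t q r` through `desSeries t q (1 + t)`. -/
lemma desSeries_mul (t q r : K) :
    desSeries t q r *
      (1 - C r * X - C (t * q) * X ^ 2 * rescale q (desSeries t q (1 + t))) = 1 := by
  have hF := desSeries_eq t q r
  have hG := congrArg (rescale q) (desSeries_eq t q (1 + t))
  have hW := congrArg (rescale q) (desSeries_eq t q 1)
  have hQ := firstSeries_eq t q
  simp only [map_add, map_mul, map_one, map_sub, rescale_X, rescale_C_apply] at hG hW hQ hF ⊢
  set Q := firstSeries t q
  set G := rescale q (desSeries t q (1 + t))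
  set W := rescale q (desSeries t q 1)
  set D := rescale q Q
  -- The elimination of `Q`: `W` has inverse u, while `Q - 1` equals `X` divided by u - t q x. Since
  -- the linear coefficient `1 + t` subtracts the same t q x after rescaling, `G` is the inverse of
  -- u - t q x as well, so `Q - 1 = X * G`.
  have hW' : W * (1 - C q * X - C q * X * (C t * C q * (D - 1))) = 1 := by
    linear_combination hW
  have hY : (Q - 1) * (1 - C q * X - C q * X * (C t * C q * (D - 1)) - C t * C q * X) = X := by
    linear_combination (1 - C q * X - C q * X * (C t * C q * (D - 1))) * hQ +
      X * (1 + C t * C q * (Q - 1)) * hW'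
  have hG' : G * (1 - C q * X - C q * X * (C t * C q * (D - 1)) - C t * C q * X) = 1 := by
    linear_combination hG
  have key : Q - 1 = X * G := by
    linear_combination G * hY - (Q - 1) * hG'
  linear_combination hF + X * C t * C q * desSeries t q r * key

end Series

end QNarayana

namespace QNarayana

open PowerSeries

/-! ### Uniqueness for the functional equation, and weighted Motzkin paths -/

section Series

variable {K : Type*} [CommRing K]

/-- Solved for `G`, the equation expresses each coefficient through strictly earlier ones, so the
coefficients agree by strong induction. -/
lemma eq_of_functional_equation {c d q : K} {G G' : K⟦X⟧}
    (hG : G * (1 - C c * X - C d * X ^ 2 * rescale q G) = 1)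
    (hG' : G' * (1 - C c * X - C d * X ^ 2 * rescale q G') = 1) : G = G' := by
  have step : ∀ {F : K⟦X⟧}, F * (1 - C c * X - C d * X ^ 2 * rescale q F) = 1 →
      F = 1 + X * (C c * F + X * (C d * (F * rescale q F))) := by
    intro F hF
    linear_combination hF
  ext n
  induction n using Nat.strong_induction_on with
  | _ n ih =>
    rw [step hG, step hG']
    rcases n with _ | n
    · simp
    · simp only [map_add, coeff_succ_X_mul, coeff_C_mul]
      rw [ih n (Nat.lt_succ_self n)]
      congr 2
      rcases n with _ | n
      · simp
      · rw [coeff_succ_X_mul, coeff_succ_X_mul, coeff_C_mul, coeff_C_mul, coeff_mul, coeff_mul]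
        congr 1
        refine Finset.sum_congr rfl fun x hx => ?_
        rw [Finset.HasAntidiagonal.mem_antidiagonal] at hx
        rw [coeff_rescale, coeff_rescale, ih x.1 (by omega), ih x.2 (by omega)]

/-- The weighted count of Motzkin paths of length `n` from height `h` to height `0`. -/
def pathSum (t q r : K) : ℕ → ℕ → K
  | 0, h => if h = 0 then 1 else 0
  | n + 1, 0 => r * pathSum t q r n 0 + t * q * pathSum t q r n 1
  | n + 1, h + 1 => (1 + t) * q ^ (h + 1) * pathSum t q r n (h + 1) +
      t * q ^ (h + 2) * pathSum t q r n (h + 2) + q ^ h * pathSum t q r n h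

/-- The generating function of `pathSum` at height `h`. -/
noncomputable def pathSeries (t q r : K) (h : ℕ) : K⟦X⟧ :=
  desSeries t q r *
    ∏ i ∈ Finset.range h, (C (q ^ i) * X * rescale (q ^ (i + 1)) (desSeries t q (1 + t)))

lemma pathSeries_zero (t q r : K) : pathSeries t q r 0 = desSeries t q r := by
  simp [pathSeries]

/-- First-passage decomposition: the last factor accounts for the part of a path from height `h + 1`
that stays at that height or above, followed by the first step down to `h`, of weight `q ^ h`. -/
lemma pathSeries_succ (t q r : K) (h : ℕ) :
    pathSeries t q r (h + 1) = pathSeries t q r h *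
      (C (q ^ h) * X * rescale (q ^ (h + 1)) (desSeries t q (1 + t))) := by
  simp only [pathSeries, Finset.prod_range_succ, mul_assoc]

lemma pathSeries_zero_eq (t q r : K) :
    pathSeries t q r 0 =
      1 + X * (C r * pathSeries t q r 0 + C (t * q) * pathSeries t q r 1) := by
  have h := desSeries_mul t q r
  rw [pathSeries_succ, pathSeries_zero, pow_zero, zero_add, pow_one, map_one]
  linear_combination h

lemma pathSeries_succ_eq (t q r : K) (h : ℕ) :
    pathSeries t q r (h + 1) =
      X * (C ((1 + t) * q ^ (h + 1)) * pathSeries t q r (h + 1) +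
        C (t * q ^ (h + 2)) * pathSeries t q r (h + 2) + C (q ^ h) * pathSeries t q r h) := by
  have hG := congrArg (rescale (q ^ (h + 1))) (desSeries_mul t q (1 + t))
  simp only [map_mul, map_sub, map_one, map_pow, rescale_X, rescale_C_apply, rescale_rescale] at hG
  rw [show q * q ^ (h + 1) = q ^ (h + 1 + 1) by ring] at hG
  rw [pathSeries_succ t q r (h + 1), pathSeries_succ t q r h]
  simp only [map_mul, map_pow, map_add, map_one] at hG ⊢
  linear_combination (pathSeries t q r h * C q ^ h * X) * hG

/-- Both sides obey the same first-step recursion, so no manipulation of paths is needed. -/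
lemma coeff_pathSeries (t q r : K) (n : ℕ) :
    ∀ h, coeff n (pathSeries t q r h) = pathSum t q r n h := by
  induction n with
  | zero =>
    rintro (_ | h)
    · rw [pathSeries_zero, coeff_zero_desSeries, pathSum, if_pos rfl]
    · rw [pathSeries_succ_eq, coeff_zero_X_mul, pathSum, if_neg (Nat.succ_ne_zero h)]
  | succ n ih =>
    rintro (_ | h)
    · rw [pathSeries_zero_eq, map_add, coeff_succ_X_mul, map_add, coeff_C_mul, coeff_C_mul, ih, ih,
        coeff_one, if_neg (Nat.succ_ne_zero n), zero_add, pathSum]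
    · rw [pathSeries_succ_eq, coeff_succ_X_mul, map_add, map_add, coeff_C_mul, coeff_C_mul,
        coeff_C_mul, ih, ih, ih, pathSum]

end Series

/-! ### The two specialisations of the continued fraction -/

section Contraction

variable {K : Type*} [Field K]

lemma desSeries_div_one {t q : K} (hq : q ≠ 0) :
    desSeries (t / q) q 1 = 1 + X * desSeries t q (1 + t) := by
  have hW := desSeries_mul (t / q) q 1
  have hG := desSeries_mul (t / q) q (1 + t / q)
  have hWq := congrArg (rescale q) hW
  have hGq := congrArg (rescale q) hG
  have ht : (C t : K⟦X⟧) = C q * C (t / q) := by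
    rw [← map_mul, mul_div_cancel₀ t hq]
  set W := desSeries (t / q) q 1
  set G := desSeries (t / q) q (1 + t / q)
  simp only [map_mul, map_sub, map_one, map_pow, map_add, rescale_X, rescale_C_apply]
    at hW hG hWq hGq
  set H := rescale q G
  set Wq := rescale q W with hWq_def
  set Hq := rescale q H
  -- `H` and `Wq` have inverses differing only in the linear term, by `C t * X`.
  have hH : H = Wq + C t * X * H * Wq := by
    rw [ht]
    linear_combination Wq * hGq - H * hWq
  -- The cofactor of `X` is the candidate V for `desSeries t q (1 + t)`. Its equation reduces to
  -- that of `W` by first replacing 1 + q x V(q x) with `Wq` and then applying `hH`.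
  have hV : W = 1 + X * (W * (1 + C t * X * H)) := by
    rw [ht]
    linear_combination hW
  rw [hV]
  congr 2
  refine eq_of_functional_equation ?_ (desSeries_mul t q (1 + t))
  have hVq := congrArg (rescale q) hV
  rw [← hWq_def, map_add, map_mul, map_one, rescale_X] at hVq
  set Vq := rescale q (W * (1 + C t * X * H))
  rw [ht] at hH ⊢
  simp only [map_mul, map_add, map_one]
  rw [ht]
  linear_combination hW + (W * (1 + C q * C (t / q) * X * H) * C q * C (t / q) * X) * hVq +
    W * C q * C (t / q) * X * hH

lemma desSeries_self {t q : K} (ht : t ≠ 0) :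
    desSeries t q t = 1 + C t * X * rescale t (desSeries (q / t) q (1 + q / t)) := by
  have hW := desSeries_mul t q t
  have hG := desSeries_mul t q (1 + t)
  have hWq := congrArg (rescale q) hW
  have hGq := congrArg (rescale q) hG
  set W := desSeries t q t
  set G := desSeries t q (1 + t)
  simp only [map_mul, map_sub, map_one, map_pow, map_add, rescale_X, rescale_C_apply]
    at hW hG hWq hGq
  set H := rescale q G
  set Wq := rescale q W with hWq_def
  set Hq := rescale q H
  have hH : H = Wq + C q * X * H * Wq := by
    linear_combination Wq * hGq - H * hWq
  set V := W * (1 + C q * X * H) with hVdef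
  have hV : W = 1 + C t * X * V := by
    rw [hVdef]
    linear_combination hW
  have hVq := congrArg (rescale q) hV
  rw [← hWq_def] at hVq
  simp only [map_add, map_mul, map_one, rescale_X, rescale_C_apply] at hVq
  have key : V * (1 - (C t + C q) * X - C t * C q ^ 2 * X ^ 2 * rescale q V) = 1 := by
    rw [hVdef]
    rw [hVdef] at hVq
    linear_combination hW + (W * (1 + C q * X * H) * C q * X) * hVq + W * C q * X * hH
  -- Substituting x/t turns the coefficients t + q and t q² of `key` into 1 + q/t and q²/t, which
  -- are those of the functional equation at parameters q/t and q.
  have hU : rescale t⁻¹ V = desSeries (q / t) q (1 + q / t) := by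
    refine eq_of_functional_equation ?_ (desSeries_mul (q / t) q (1 + q / t))
    have h := congrArg (rescale t⁻¹) key
    simp only [map_mul, map_sub, map_one, map_pow, map_add, rescale_X, rescale_C_apply,
      rescale_rescale] at h
    rw [rescale_rescale, mul_comm t⁻¹ q]
    have h1 : (C t : K⟦X⟧) * C t⁻¹ = 1 := by
      rw [← map_mul, mul_inv_cancel₀ ht, map_one]
    rw [div_eq_mul_inv]
    simp only [map_mul, map_add, map_one]
    set U := rescale t⁻¹ V
    set U' := rescale (q * t⁻¹) V
    linear_combination h + U * X * h1 + (U * C q ^ 2 * C t⁻¹ * X ^ 2 * U') * h1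
  rw [← hU, rescale_rescale, inv_mul_cancel₀ ht, rescale_one]
  exact hV

end Contraction

end QNarayana

namespace QNarayana

/-! ### Bicoloured Motzkin paths as words of step pairs -/

section PathWeight

variable {K : Type*} [CommRing K]

/-- The weight of a bicoloured Motzkin path starting at height `h`. A step `(e, v)` changes the
height by `e - v`, and `v` is allowed only at positive height. -/
def pathWeight (t q r : K) : (n : ℕ) → ℕ → (Fin n → Bool × Bool) → K
  | 0, h, _ => if h = 0 then 1 else 0
  | n + 1, h, w =>
    if (w 0).2 = true ∧ h = 0 then 0
    else (if (w 0).1 = true then t else 1) * q ^ (h + (w 0).1.toNat - (w 0).2.toNat) *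
      (if w 0 = (false, false) ∧ h = 0 then r else 1) *
      pathWeight t q r n (h + (w 0).1.toNat - (w 0).2.toNat) (Fin.tail w)

lemma sum_pathWeight (t q r : K) (n : ℕ) :
    ∀ h, ∑ w, pathWeight t q r n h w = pathSum t q r n h := by
  induction n with
  | zero => intro h; simp [pathWeight, pathSum]
  | succ n ih =>
    intro h
    rw [← (Fin.consEquiv fun _ => Bool × Bool).sum_comp, Fintype.sum_prod_type,
      Fintype.sum_prod_type, Fintype.sum_bool, Fintype.sum_bool, Fintype.sum_bool]
    rcases h with _ | h
    · simp [Fin.consEquiv, pathWeight, pathSum, ← Finset.mul_sum, ih]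
      ring
    · simp [Fin.consEquiv, pathWeight, pathSum, ← Finset.mul_sum, ih]
      ring

/-- `g` lists the heights of the path `w`, which ends at height `0`. -/
structure IsHeight {n : ℕ} (g : ℕ → ℕ) (w : Fin n → Bool × Bool) : Prop where
  last : g n = 0
  step : ∀ i : Fin n, g (i + 1) + (w i).2.toNat = g i + (w i).1.toNat
  pos : ∀ i : Fin n, (w i).2 = true → 0 < g i

lemma IsHeight.tail {n : ℕ} {g : ℕ → ℕ} {w : Fin (n + 1) → Bool × Bool} (h : IsHeight g w) :
    IsHeight (fun i => g (i + 1)) (Fin.tail w) where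
  last := h.last
  step i := h.step i.succ
  pos i := h.pos i.succ

lemma pathWeight_eq_prod (t q r : K) {n : ℕ} :
    ∀ {g : ℕ → ℕ} {w : Fin n → Bool × Bool}, IsHeight g w →
      pathWeight t q r n (g 0) w = ∏ i : Fin n, ((if (w i).1 = true then t else 1) *
        q ^ g (i + 1) * (if w i = (false, false) ∧ g i = 0 then r else 1)) := by
  induction n with
  | zero => intro g w h; simp [pathWeight, h.last]
  | succ n ih =>
    intro g w h
    have ih' := ih h.tail
    have hs := h.step 0
    have hp := h.pos 0
    rw [Fin.prod_univ_succ]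
    simp only [Fin.val_succ, Fin.val_zero, zero_add] at ih' hs hp ⊢
    change _ = _ * ∏ i : Fin n, ((if (Fin.tail w i).1 = true then t else 1) *
        q ^ g (i + 1 + 1) * (if Fin.tail w i = (false, false) ∧ g (i + 1) = 0 then r else 1))
    rw [← ih', pathWeight, if_neg (fun hc => (hp hc.1).ne' hc.2), ← hs, Nat.add_sub_cancel]
    rfl

/-- Nonzero weight forces the word to be a genuine path. It disposes of the words outside the image
of `excCode`, which contribute zero. -/
lemma exists_isHeight (t q r : K) {n : ℕ} :
    ∀ {h : ℕ} {w : Fin n → Bool × Bool}, pathWeight t q r n h w ≠ 0 →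
      ∃ g, g 0 = h ∧ IsHeight g w := by
  induction n with
  | zero =>
    intro h w hw
    refine ⟨fun _ => 0, ?_, rfl, fun i => i.elim0, fun i => i.elim0⟩
    by_contra hc
    exact hw (if_neg fun h => hc h.symm)
  | succ n ih =>
    intro h w hw
    have glue : ∀ b, pathWeight t q r n b (Fin.tail w) ≠ 0 →
        b + (w 0).2.toNat = h + (w 0).1.toNat → ((w 0).2 = true → 0 < h) →
        ∃ g, g 0 = h ∧ IsHeight g w := by
      intro b hb hs hp
      obtain ⟨g, rfl, hg⟩ := ih hb
      refine ⟨fun i => Nat.casesOn i h g, rfl, hg.last, fun i => ?_, fun i => ?_⟩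
      · exact Fin.cases hs (fun i => hg.step i) i
      · exact Fin.cases hp (fun i => hg.pos i) i
    rw [pathWeight] at hw
    obtain ⟨hpos, hw⟩ := ite_ne_left_iff.1 hw
    have hp : (w 0).2 = true → 0 < h := fun hv => Nat.pos_of_ne_zero fun h0 => hpos ⟨hv, h0⟩
    refine glue _ (right_ne_zero_of_mul hw.symm) (Nat.sub_add_cancel ?_) hp
    cases hv : (w 0).2
    · simp
    · have := hp hv
      simp only [Bool.toNat_true]
      omega

end PathWeight

/-! ### From `321`-avoiders to paths -/

section Code

variable {n : ℕ} (σ : Equiv.Perm (Fin n))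

/-- The excedance positions and excedance values of `σ`. -/
def excCode (i : Fin n) : Bool × Bool := (decide (i < σ i), decide (σ.symm i < i))

/-- The number of `j < i` with `i ≤ σ j`. -/
def excHeight (i : ℕ) : ℕ := ∑ j : Fin n, if j.val < i ∧ i ≤ (σ j).val then 1 else 0

lemma isHeight_excHeight : IsHeight (excHeight σ) (excCode σ) where
  last := by
    refine Finset.sum_eq_zero fun j _ => if_neg ?_
    have := (σ j).isLt
    omega
  step i := by
    have hv : (excCode σ i).2.toNat =
        ∑ j : Fin n, if j = σ.symm i ∧ j < i then 1 else 0 := by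
      rw [Finset.sum_eq_single (σ.symm i)]
      · by_cases h : σ.symm i < i <;> simp [excCode, h]
      · intro j _ hj; simp [hj]
      · simp
    have he : (excCode σ i).1.toNat = ∑ j : Fin n, if j = i ∧ i < σ j then 1 else 0 := by
      rw [Finset.sum_eq_single i]
      · by_cases h : i < σ i <;> simp [excCode, h]
      · intro j _ hj; simp [hj]
      · simp
    rw [hv, he, excHeight, excHeight, ← Finset.sum_add_distrib, ← Finset.sum_add_distrib]
    refine Finset.sum_congr rfl fun j _ => ?_
    simp only [Equiv.eq_symm_apply, Fin.ext_iff, Fin.lt_def]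
    split_ifs <;> omega
  pos i := by
    intro h
    have h : σ.symm i < i := by simpa [excCode] using h
    refine Finset.sum_pos' (fun _ _ => Nat.zero_le _) ⟨σ.symm i, Finset.mem_univ _, ?_⟩
    rw [if_pos]
    · exact Nat.one_pos
    · simpa using h

lemma excHeight_zero : excHeight σ 0 = 0 := by simp [excHeight]

variable {σ}

/-- If an earlier letter were larger, avoidance would push every value below `σ j` into a position
before `j`, and there are more such values than positions because `j < σ j`. -/
lemma lt_of_exc (hσ : σ ∈ avoiders n ![3, 2, 1]) {i j : Fin n} (hj : j < σ j) (hij : i < j) :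
    σ i < σ j := by
  rw [mem_avoiders_321] at hσ
  by_contra hc
  have hc : σ j < σ i := lt_of_le_of_ne (not_lt.1 hc) fun h => hij.ne (σ.injective h).symm
  have hm : Set.MapsTo σ.symm (Finset.Iio (σ j) : Finset (Fin n)) (Finset.Iio j : Finset (Fin n)) := by
    intro v hv
    simp only [Finset.coe_Iio, Set.mem_Iio] at hv ⊢
    by_contra hvj
    have hne : j ≠ σ.symm v := fun h => by
      rw [h, Equiv.apply_symm_apply] at hv
      exact lt_irrefl _ hv
    exact hσ i j (σ.symm v) hij (lt_of_le_of_ne (not_lt.1 hvj) hne) ⟨hc, by simpa using hv⟩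
  have := Finset.card_le_card_of_injOn σ.symm hm σ.symm.injective.injOn
  rw [Fin.card_Iio, Fin.card_Iio] at this
  exact absurd (Fin.lt_def.1 hj) (by omega)

/-- If a later letter at `k` were smaller, avoidance would put all letters before `i` below `σ i`;
together with `σ k` these are too many values below `σ i ≤ i`. -/
lemma lt_of_not_exc (hσ : σ ∈ avoiders n ![3, 2, 1]) {i k : Fin n} (hi : ¬ i < σ i) (hik : i < k) :
    σ i < σ k := by
  rw [mem_avoiders_321] at hσ
  by_contra hc
  have hc : σ k < σ i := lt_of_le_of_ne (not_lt.1 hc) fun h => hik.ne (σ.injective h).symm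
  have hm : Set.MapsTo σ (insert k (Finset.Iio i) : Finset (Fin n))
      (Finset.Iio (σ i) : Finset (Fin n)) := by
    intro p hp
    simp only [Finset.coe_insert, Finset.coe_Iio, Set.mem_insert_iff, Set.mem_Iio] at hp ⊢
    rcases hp with rfl | hp
    · exact hc
    · by_contra hpi
      have hne : σ i ≠ σ p := fun h => hp.ne (σ.injective h).symm
      exact hσ p i k hp hik ⟨lt_of_le_of_ne (not_lt.1 hpi) hne, hc⟩
  have := Finset.card_le_card_of_injOn σ hm σ.injective.injOn
  rw [Finset.card_insert_of_notMem (by simpa using hik.le), Fin.card_Iio, Fin.card_Iio] at this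
  exact absurd (Fin.le_def.1 (not_lt.1 hi)) (by omega)

/-- After exchanging sums, an excedance `j` contributes `σ j - j` to the heights. It also starts
exactly that many inversions, since all `j` earlier letters lie among the `σ j` values below it. A
non-excedance contributes nothing to either side. -/
lemma sum_excHeight (hσ : σ ∈ avoiders n ![3, 2, 1]) :
    ∑ i : Fin n, excHeight σ (i + 1) = inv σ := by
  classical
  rw [inv, Nat.card_eq_fintype_card, Fintype.card_subtype, Finset.card_filter,
    Fintype.sum_prod_type]
  unfold excHeight
  rw [Finset.sum_comm]
  refine Finset.sum_congr rfl fun j _ => ?_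
  simp only
  by_cases hj : j < σ j
  · have h1 : (∑ k : Fin n, if j < k ∧ σ k < σ j then 1 else 0) +
        ∑ k : Fin n, (if k < j then 1 else 0)
        = ∑ k : Fin n, if σ k < σ j then 1 else 0 := by
      rw [← Finset.sum_add_distrib]
      refine Finset.sum_congr rfl fun k _ => ?_
      rcases lt_trichotomy j k with h | rfl | h
      · simp [h, h.not_gt]
      · simp
      · simp [h, h.not_gt, lt_of_exc hσ hj h]
    have h2 : (∑ i : Fin n, if j.val < i.val + 1 ∧ i.val + 1 ≤ (σ j).val then 1 else 0) +
        ∑ k : Fin n, (if k < j then 1 else 0) = ∑ k : Fin n, if k < σ j then 1 else 0 := by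
      rw [← Finset.sum_add_distrib]
      refine Finset.sum_congr rfl fun k _ => ?_
      simp only [Fin.lt_def] at hj ⊢
      split_ifs <;> omega
    rw [Equiv.sum_comp σ (fun k => if k < σ j then 1 else 0)] at h1
    omega
  · rw [Finset.sum_eq_zero, Finset.sum_eq_zero]
    · intro k _
      exact if_neg fun h => lt_asymm h.2 (lt_of_not_exc hσ hj h.1)
    · intro k _
      rw [Fin.lt_def] at hj
      exact if_neg (by omega)

/-- Height zero means that the positions before `i` are stable, so a non-excedance at `i` must be
fixed. Conversely, an earlier letter jumping over a fixed point would have to share the values above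
`i` with all the later letters, leaving too few. -/
lemma excCode_eq_iff_fixed (hσ : σ ∈ avoiders n ![3, 2, 1]) (i : Fin n) :
    excCode σ i = (false, false) ∧ excHeight σ i = 0 ↔ σ i = i := by
  have hz : excHeight σ i = 0 ↔ ∀ j, j < i → σ j < i := by
    simp [excHeight]
  rw [hz]
  simp only [excCode, Prod.mk.injEq, decide_eq_false_iff_not]
  constructor
  · rintro ⟨⟨h1, -⟩, h2⟩
    by_contra hne
    have hm : Set.MapsTo σ (Finset.Iic i : Finset (Fin n)) (Finset.Iio i : Finset (Fin n)) := by
      intro p hp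
      simp only [Finset.coe_Iic, Finset.coe_Iio, Set.mem_Iic, Set.mem_Iio] at hp ⊢
      rcases hp.lt_or_eq with h | rfl
      · exact h2 p h
      · exact lt_of_le_of_ne (not_lt.1 h1) hne
    have := Finset.card_le_card_of_injOn σ hm σ.injective.injOn
    rw [Fin.card_Iic, Fin.card_Iio] at this
    omega
  · intro h
    have hs : σ.symm i = i := by rw [Equiv.symm_apply_eq, h]
    refine ⟨⟨by rw [h]; exact lt_irrefl _, by rw [hs]; exact lt_irrefl _⟩, fun j hj => ?_⟩
    by_contra hc
    have hne : i ≠ σ j := fun he => hj.ne (by rw [← hs, he, Equiv.symm_apply_apply])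
    have hm : Set.MapsTo σ (insert j (Finset.Ioi i) : Finset (Fin n))
        (Finset.Ioi i : Finset (Fin n)) := by
      intro p hp
      simp only [Finset.coe_insert, Finset.coe_Ioi, Set.mem_insert_iff, Set.mem_Ioi] at hp ⊢
      rcases hp with rfl | hp
      · exact lt_of_le_of_ne (not_lt.1 hc) hne
      · have := lt_of_not_exc hσ (i := i) (by rw [h]; exact lt_irrefl _) hp
        rwa [h] at this
    have := Finset.card_le_card_of_injOn σ hm σ.injective.injOn
    rw [Finset.card_insert_of_notMem (by simpa using hj.le)] at this
    omega

lemma pathWeight_excCode {K : Type*} [CommRing K] (t q r : K) (hσ : σ ∈ avoiders n ![3, 2, 1]) :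
    pathWeight t q r n 0 (excCode σ) = t ^ exc σ * q ^ inv σ * r ^ fix σ := by
  classical
  have h := pathWeight_eq_prod t q r (isHeight_excHeight σ)
  rw [excHeight_zero] at h
  rw [h, Finset.prod_mul_distrib, Finset.prod_mul_distrib, Finset.prod_pow_eq_pow_sum,
    sum_excHeight hσ, exc, fix, Nat.card_eq_fintype_card, Nat.card_eq_fintype_card,
    Fintype.card_subtype, Fintype.card_subtype]
  simp only [excCode_eq_iff_fixed hσ]
  simp only [excCode, decide_eq_true_eq, Finset.prod_ite, Finset.prod_const, one_pow, mul_one]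

/-- A `321`-avoider is increasing on its excedances and on its non-excedances, and the code records
the domain and range of both restrictions. -/
lemma excCode_injOn : Set.InjOn excCode (avoiders n ![3, 2, 1] : Set (Equiv.Perm (Fin n))) := by
  intro σ hσ ρ hρ h
  rw [Finset.mem_coe] at hσ hρ
  have hE : ∀ i, i < σ i ↔ i < ρ i := fun i => by
    simpa [excCode] using congrArg Prod.fst (congrFun h i)
  have hV : ∀ i, σ.symm i < i ↔ ρ.symm i < i := fun i => by
    simpa [excCode] using congrArg Prod.snd (congrFun h i)
  have h1 : (fun x : {i // i < σ i} => σ x.val) = fun x => ρ x.val := by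
    refine (StrictMono.range_inj ?_ ?_).1 ?_
    · exact fun x y hxy => lt_of_exc hσ y.2 hxy
    · exact fun x y hxy => lt_of_exc hρ ((hE _).1 y.2) hxy
    · ext v
      constructor
      · rintro ⟨⟨x, hx⟩, rfl⟩
        have hv := (hV (σ x)).1 (by simpa using hx)
        exact ⟨⟨ρ.symm (σ x), (hE _).2 (by simpa using hv)⟩, by simp⟩
      · rintro ⟨⟨x, hx⟩, rfl⟩
        have hv := (hV (ρ x)).2 (by simpa using (hE _).1 hx)
        exact ⟨⟨σ.symm (ρ x), by simpa using hv⟩, by simp⟩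
  have h2 : (fun x : {i // ¬ i < σ i} => σ x.val) = fun x => ρ x.val := by
    refine (StrictMono.range_inj ?_ ?_).1 ?_
    · exact fun x y hxy => lt_of_not_exc hσ x.2 hxy
    · exact fun x y hxy => lt_of_not_exc hρ (mt (hE _).2 x.2) hxy
    · ext v
      constructor
      · rintro ⟨⟨x, hx⟩, rfl⟩
        have hv := mt (hV (σ x)).2 (by simpa using hx)
        exact ⟨⟨ρ.symm (σ x), mt (hE _).1 (by simpa using hv)⟩, by simp⟩
      · rintro ⟨⟨x, hx⟩, rfl⟩
        have hv := mt (hV (ρ x)).1 (by simpa using mt (hE _).2 hx)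
        exact ⟨⟨σ.symm (ρ x), by simpa using hv⟩, by simp⟩
  ext i
  by_cases hi : i < σ i
  · exact congrArg Fin.val (congrFun h1 ⟨i, hi⟩)
  · exact congrArg Fin.val (congrFun h2 ⟨i, hi⟩)

end Code

/-! ### From paths back to `321`-avoiders -/

section Surjectivity

variable {n : ℕ} {g : ℕ → ℕ} {w : Fin n → Bool × Bool}

lemma card_filter_val_lt_succ (p : Fin n → Prop) [DecidablePred p] (i : Fin n) :
    (Finset.univ.filter fun j : Fin n => p j ∧ j.val < i.val + 1).card =
      (Finset.univ.filter fun j : Fin n => p j ∧ j.val < i.val).card + if p i then 1 else 0 := by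
  have : (if p i then 1 else 0) = ∑ j : Fin n, if j = i ∧ p j then 1 else 0 := by
    rw [Finset.sum_eq_single i]
    · simp
    · intro j _ hj; simp [hj]
    · simp
  rw [this, Finset.card_filter, Finset.card_filter, ← Finset.sum_add_distrib]
  refine Finset.sum_congr rfl fun j _ => ?_
  by_cases hp : p j
  · simp only [hp, true_and, and_true, Fin.ext_iff]
    split_ifs <;> omega
  · simp [hp]

lemma IsHeight.card_eq (hg : IsHeight g w) (h0 : g 0 = 0) (m : ℕ) (hm : m ≤ n) :
    g m + (Finset.univ.filter fun j : Fin n => (w j).2 = true ∧ j.val < m).card =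
      (Finset.univ.filter fun j : Fin n => (w j).1 = true ∧ j.val < m).card := by
  induction m with
  | zero => simp [h0]
  | succ m ih =>
    have h1 := card_filter_val_lt_succ (fun j => (w j).1 = true) ⟨m, hm⟩
    have h2 := card_filter_val_lt_succ (fun j => (w j).2 = true) ⟨m, hm⟩
    have h3 := hg.step ⟨m, hm⟩
    have := ih (by omega)
    simp only at h1 h2 h3
    rw [h1, h2]
    cases he : (w ⟨m, hm⟩).1 <;> cases hv : (w ⟨m, hm⟩).2 <;> simp [he, hv] at h3 ⊢ <;> omega

lemma exists_perm_of_card_eq (p p' : Fin n → Prop) [DecidablePred p] [DecidablePred p']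
    (h : (Finset.univ.filter p).card = (Finset.univ.filter p').card) :
    ∃ σ : Equiv.Perm (Fin n), (∀ i, p' (σ i) ↔ p i) ∧
      (∀ i j, p i → p j → i < j → σ i < σ j) ∧ (∀ i j, ¬ p i → ¬ p j → i < j → σ i < σ j) := by
  have h1 : Fintype.card {i // p i} = Fintype.card {i // p' i} := by
    rwa [Fintype.card_subtype, Fintype.card_subtype]
  have h2 : Fintype.card {i // ¬ p i} = Fintype.card {i // ¬ p' i} := by
    rw [Fintype.card_subtype_compl, Fintype.card_subtype_compl, h1]
  let e : {i // p i} ≃o {i // p' i} :=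
    (Fintype.orderIsoFinOfCardEq _ h1).symm.trans (Fintype.orderIsoFinOfCardEq _ rfl)
  let f : {i // ¬ p i} ≃o {i // ¬ p' i} :=
    (Fintype.orderIsoFinOfCardEq _ h2).symm.trans (Fintype.orderIsoFinOfCardEq _ rfl)
  have hp : ∀ i (hi : p i), Equiv.subtypeCongr e.toEquiv f.toEquiv i = e ⟨i, hi⟩ := by
    intro i hi
    simp [Equiv.subtypeCongr, hi]
  have hn : ∀ i (hi : ¬ p i), Equiv.subtypeCongr e.toEquiv f.toEquiv i = f ⟨i, hi⟩ := by
    intro i hi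
    simp [Equiv.subtypeCongr, hi]
  refine ⟨Equiv.subtypeCongr e.toEquiv f.toEquiv, fun i => ?_, fun i j hi hj hij => ?_,
    fun i j hi hj hij => ?_⟩
  · by_cases hi : p i
    · rw [hp i hi]
      exact ⟨fun _ => hi, fun _ => (e _).2⟩
    · rw [hn i hi]
      exact ⟨fun h => absurd h (f _).2, fun h => absurd h hi⟩
  · rw [hp i hi, hp j hj]
    exact e.strictMono hij
  · rw [hn i hi, hn j hj]
    exact f.strictMono hij

/-- The candidate maps the prescribed excedance positions increasingly onto the prescribed excedance
values, and likewise the complements. Nonnegative heights, and positive ones where a value is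
marked, make the excedances of this permutation the prescribed ones. -/
lemma IsHeight.exists_excCode_eq (hg : IsHeight g w) (h0 : g 0 = 0) :
    ∃ σ ∈ avoiders n ![3, 2, 1], excCode σ = w := by
  have hcard := hg.card_eq h0
  obtain ⟨σ, hmem, hE, hN⟩ := exists_perm_of_card_eq (fun i => (w i).1 = true)
    (fun i => (w i).2 = true) (by
      have := hcard n le_rfl
      simp only [Fin.is_lt, and_true, hg.last, zero_add] at this
      exact this.symm)
  have hexc : ∀ i, (w i).1 = true → i < σ i := by
    intro i hi
    by_contra hc
    have hc := Fin.le_def.1 (not_lt.1 hc)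
    -- Monotonicity sends every marked position up to `i` to a marked value up to `i`. This forces
    -- `g (i + 1) = 0`, impossible after a step with first entry `true`.
    have hle : (Finset.univ.filter fun j : Fin n => (w j).1 = true ∧ j.val < i.val + 1).card ≤
        (Finset.univ.filter fun j : Fin n => (w j).2 = true ∧ j.val < i.val + 1).card := by
      refine Finset.card_le_card_of_injOn σ (fun j hj => ?_) σ.injective.injOn
      simp only [Finset.coe_filter, Finset.mem_univ, true_and, Set.mem_ofPred_eq] at hj ⊢
      refine ⟨(hmem j).2 hj.1, ?_⟩
      rcases Nat.lt_or_ge j i with h | h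
      · have := Fin.lt_def.1 (hE j i hj.1 hi h)
        omega
      · obtain rfl : j = i := Fin.ext (by omega)
        omega
    have h1 := hcard (i + 1) i.isLt
    have h2 := hg.step i
    have h3 := hg.pos i
    cases hv : (w i).2 <;> simp [hv, hi] at h2 h3 <;> omega
  have hnexc : ∀ i, ¬ (w i).1 = true → σ i ≤ i := by
    intro i hi
    by_contra hc
    have hc := Fin.lt_def.1 (not_le.1 hc)
    -- Unmarked values up to `i` come from unmarked positions strictly before `i`. Passing to
    -- complements, the marked values up to `i` outnumber the marked positions, against `0 ≤ g (i +
    -- 1)`.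
    have hle : (Finset.univ.filter fun j : Fin n => ¬ (w j).2 = true ∧ j.val < i.val + 1).card ≤
        (Finset.univ.filter fun j : Fin n => ¬ (w j).1 = true ∧ j.val < i.val).card := by
      refine Finset.card_le_card_of_injOn σ.symm (fun j hj => ?_) σ.symm.injective.injOn
      simp only [Finset.coe_filter, Finset.mem_univ, true_and, Set.mem_ofPred_eq] at hj ⊢
      have hj1 : ¬ (w (σ.symm j)).1 = true := by
        rw [← hmem, Equiv.apply_symm_apply]
        exact hj.1
      refine ⟨hj1, ?_⟩
      by_contra hji
      rcases (not_lt.1 hji).lt_or_eq with h | h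
      · have := Fin.lt_def.1 (hN _ _ hi hj1 h)
        rw [Equiv.apply_symm_apply] at this
        omega
      · rw [Fin.ext h, Equiv.apply_symm_apply] at hc
        omega
    have hsplit : ∀ (p : Fin n → Prop) [DecidablePred p] (m : ℕ), m ≤ n →
        (Finset.univ.filter fun j : Fin n => p j ∧ j.val < m).card +
          (Finset.univ.filter fun j : Fin n => ¬ p j ∧ j.val < m).card = m := by
      intro p _ m hm
      have := Finset.card_filter_add_card_filter_not
        (s := Finset.univ.filter fun j : Fin n => j.val < m) p
      rw [Finset.filter_filter, Finset.filter_filter, Fin.card_filter_val_lt] at this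
      simp only [and_comm (b := _ < m)]
      omega
    have h1 := hcard (i + 1) i.isLt
    have h2 := card_filter_val_lt_succ (fun j => (w j).1 = true) i
    rw [if_neg hi] at h2
    have h3 := hsplit (fun j => (w j).2 = true) (i + 1) i.isLt
    have h4 := hsplit (fun j => (w j).1 = true) i i.isLt.le
    omega
  have hiff : ∀ i, i < σ i ↔ (w i).1 = true := fun i =>
    ⟨fun h => by_contra fun hc => absurd h (not_lt.2 (hnexc i hc)), hexc i⟩
  refine ⟨σ, ?_, ?_⟩
  · rw [mem_avoiders_321]
    rintro i j k hij hjk ⟨h1, h2⟩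
    by_cases hi : (w i).1 = true <;> by_cases hj : (w j).1 = true <;>
      by_cases hk : (w k).1 = true
    -- Two of the three positions lie in the same class, on which `σ` increases.
    all_goals first
      | exact lt_asymm h1 (hE i j ‹_› ‹_› hij)
      | exact lt_asymm h1 (hN i j ‹_› ‹_› hij)
      | exact lt_asymm h2 (hE j k ‹_› ‹_› hjk)
      | exact lt_asymm h2 (hN j k ‹_› ‹_› hjk)
      | exact lt_asymm (h2.trans h1) (hE i k ‹_› ‹_› (hij.trans hjk))
      | exact lt_asymm (h2.trans h1) (hN i k ‹_› ‹_› (hij.trans hjk))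
  · funext i
    refine Prod.ext ?_ ?_
    · rw [Bool.eq_iff_iff, excCode, decide_eq_true_eq]
      exact hiff i
    · rw [Bool.eq_iff_iff, excCode, decide_eq_true_eq]
      have h1 := hiff (σ.symm i)
      have h2 := hmem (σ.symm i)
      rw [Equiv.apply_symm_apply] at h1 h2
      rw [h1, h2]

end Surjectivity

lemma narayana_eq_pathSum {K : Type*} [CommRing K] (n : ℕ) (t q r : K) :
    narayana n t q r = pathSum t q r n 0 := by
  rw [narayana, ← sum_pathWeight]
  refine Finset.sum_of_injOn excCode excCode_injOn (fun _ _ => by simp) (fun w _ hw => ?_)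
    fun σ hσ => (pathWeight_excCode t q r hσ).symm
  by_contra hc
  obtain ⟨g, h0, hg⟩ := exists_isHeight t q r hc
  obtain ⟨σ, hσ, rfl⟩ := hg.exists_excCode_eq h0
  exact hw ⟨σ, hσ, rfl⟩

lemma narayana_eq_coeff {K : Type*} [CommRing K] (n : ℕ) (t q r : K) :
    narayana n t q r = PowerSeries.coeff n (desSeries t q r) := by
  rw [narayana_eq_pathSum, ← coeff_pathSeries, pathSeries_zero]

end QNarayana

namespace QNarayana

/-! ### Reversal and complement -/

section Symmetry

variable {n : ℕ} (σ : Equiv.Perm (Fin n))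

lemma mem_avoiders_132 :
    σ ∈ avoiders n ![1, 3, 2] ↔ ∀ i j k : Fin n, i < j → j < k → ¬ (σ i < σ k ∧ σ k < σ j) := by
  rw [mem_avoiders, contains_iff]
  simp
  grind

lemma mem_avoiders_312 :
    σ ∈ avoiders n ![3, 1, 2] ↔ ∀ i j k : Fin n, i < j → j < k → ¬ (σ j < σ k ∧ σ k < σ i) := by
  rw [mem_avoiders, contains_iff]
  simp
  grind

lemma mem_avoiders_213 :
    σ ∈ avoiders n ![2, 1, 3] ↔ ∀ i j k : Fin n, i < j → j < k → ¬ (σ j < σ i ∧ σ i < σ k) := by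
  rw [mem_avoiders, contains_iff]
  simp
  grind

/-- The complement of a permutation. -/
def complement : Equiv.Perm (Fin n) := σ.trans Fin.revPerm

/-- The reversal of a permutation. -/
def reversal : Equiv.Perm (Fin n) := Fin.revPerm.trans σ

lemma complement_complement : complement (complement σ) = σ := by
  ext i; simp [complement]

lemma reversal_reversal : reversal (reversal σ) = σ := by
  ext i; simp [reversal]

lemma complement_mem_213_iff :
    complement σ ∈ avoiders n ![2, 1, 3] ↔ σ ∈ avoiders n ![2, 3, 1] := by
  simp [mem_avoiders_213, mem_avoiders_231, complement]

lemma complement_mem_312_iff :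
    complement σ ∈ avoiders n ![3, 1, 2] ↔ σ ∈ avoiders n ![1, 3, 2] := by
  simp only [mem_avoiders_312, mem_avoiders_132, complement, Equiv.trans_apply,
    Fin.revPerm_apply, Fin.rev_lt_rev]
  simp only [and_comm]

lemma reversal_mem_132_iff :
    reversal σ ∈ avoiders n ![1, 3, 2] ↔ σ ∈ avoiders n ![2, 3, 1] := by
  simp only [mem_avoiders_231, mem_avoiders_132, reversal, Equiv.trans_apply, Fin.revPerm_apply]
  constructor
  · intro h i j k hij hjk hc
    refine h k.rev j.rev i.rev (by simpa) (by simpa) ?_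
    simpa [and_comm] using hc
  · intro h i j k hij hjk hc
    exact h k.rev j.rev i.rev (by simpa) (by simpa) hc.symm

lemma word_complement {i : ℕ} (hi : i < n) : word (complement σ) i = n - 1 - word σ i := by
  rw [word_of_lt _ hi, word_of_lt _ hi]
  simp [complement, Fin.val_rev]
  omega

lemma word_reversal {i : ℕ} (hi : i < n) : word (reversal σ) i = word σ (n - 1 - i) := by
  rw [word_of_lt _ hi, word_of_lt _ (by omega : n - 1 - i < n)]
  have : Fin.rev ⟨i, hi⟩ = ⟨n - 1 - i, by omega⟩ := Fin.ext (by rw [Fin.val_rev]; simp only; omega)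
  simp [reversal, this]

lemma word_complement_lt_iff {i j : ℕ} (hi : i < n) (hj : j < n) :
    word (complement σ) i < word (complement σ) j ↔ word σ j < word σ i := by
  have := word_lt σ hi
  have := word_lt σ hj
  rw [word_complement σ hi, word_complement σ hj]
  omega

lemma word_complement_le_iff {i j : ℕ} (hi : i < n) (hj : j < n) :
    word (complement σ) i ≤ word (complement σ) j ↔ word σ j ≤ word σ i := by
  rw [← not_lt, word_complement_lt_iff σ hj hi, not_lt]

lemma asc_complement : asc (complement σ) = des σ := by
  rw [asc_eq_sum, des_eq_sum]
  refine Finset.sum_congr rfl fun i hi => if_congr (and_congr_right fun h => ?_) rfl rfl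
  exact word_complement_lt_iff σ (by omega) h

lemma des_complement : des (complement σ) = asc σ := by
  rw [← asc_complement, complement_complement]

lemma vinc13_2_complement : vinc13_2 (complement σ) = vinc31_2 σ := by
  rw [vinc13_2_eq_sum, vinc31_2_eq_sum]
  refine Finset.sum_congr rfl fun i hi => Finset.sum_congr rfl fun j hj =>
    if_congr (and_congr_right fun h => and_congr_right fun _ => ?_) rfl rfl
  rw [Finset.mem_range] at hi hj
  rw [word_complement_lt_iff σ hi hj, word_complement_lt_iff σ hj h, and_comm]

lemma vinc2_31_complement : vinc2_31 (complement σ) = vinc2_13 σ := by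
  rw [vinc2_31_eq_sum, vinc2_13_eq_sum]
  refine Finset.sum_congr rfl fun i hi => Finset.sum_congr rfl fun j hj =>
    if_congr (and_congr_right fun h => and_congr_right fun _ => ?_) rfl rfl
  rw [Finset.mem_range] at hi hj
  rw [word_complement_lt_iff σ h hj, word_complement_lt_iff σ hj hi, and_comm]

lemma fmin_complement : fmin (complement σ) = fmax σ := by
  rw [fmin_eq_sum, fmax_eq_sum]
  refine Finset.sum_congr rfl fun i hi => if_congr (and_congr ?_ ?_) rfl rfl <;>
    rw [Finset.mem_range] at hi
  · exact forall_congr' fun h => word_complement_lt_iff σ h hi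
  · exact forall₃_congr fun j hj _ => word_complement_le_iff σ hi hj

lemma amin_complement : amin (complement σ) = amax σ := by
  rw [amin_eq_sum, amax_eq_sum]
  refine Finset.sum_congr rfl fun i hi => if_congr (and_congr ?_ ?_) rfl rfl <;>
    rw [Finset.mem_range] at hi
  · exact forall_congr' fun h => word_complement_lt_iff σ (by omega) hi
  · exact forall₃_congr fun j hj _ => word_complement_le_iff σ hi hj

/-- Reversal sends the adjacent pair starting at `i` to the one starting at `n - 2 - i`. The last
index of the range starts no pair, so its term has to vanish separately. -/
lemma sum_range_eq_of_reflect {f g : ℕ → ℕ} (n : ℕ) (hf : ∀ i, n ≤ i + 1 → f i = 0)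
    (hg : ∀ i, n ≤ i + 1 → g i = 0) (h : ∀ i, i + 1 < n → g i = f (n - 2 - i)) :
    ∑ i ∈ Finset.range n, g i = ∑ i ∈ Finset.range n, f i := by
  rcases n with _ | m
  · rfl
  · rw [Finset.sum_range_succ, Finset.sum_range_succ, hf m le_rfl, hg m le_rfl,
      ← Finset.sum_range_reflect f m]
    congr 1
    refine Finset.sum_congr rfl fun i hi => ?_
    rw [Finset.mem_range] at hi
    rw [h i (by omega), show m + 1 - 2 - i = m - 1 - i by omega]

lemma asc_reversal : asc (reversal σ) = des σ := by
  rw [asc_eq_sum, des_eq_sum]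
  refine sum_range_eq_of_reflect n (fun i hi => if_neg (by omega)) (fun i hi => if_neg (by omega))
    fun i hi => ?_
  rw [word_reversal σ hi, word_reversal σ (by omega), show n - 1 - i = n - 2 - i + 1 by omega,
    show n - 1 - (i + 1) = n - 2 - i by omega]
  exact if_congr (and_congr_left fun _ => by omega) rfl rfl

lemma vinc2_13_reversal : vinc2_13 (reversal σ) = vinc31_2 σ := by
  rw [vinc2_13_eq_sum, vinc31_2_eq_sum]
  refine sum_range_eq_of_reflect n
    (fun i hi => Finset.sum_eq_zero fun j _ => if_neg (by omega))
    (fun i hi => Finset.sum_eq_zero fun j _ => if_neg (by omega)) fun i hi => ?_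
  rw [← Finset.sum_range_reflect (fun j => if n - 2 - i + 1 < n ∧ _ then 1 else 0) n]
  refine Finset.sum_congr rfl fun j hj => ?_
  rw [Finset.mem_range] at hj
  rw [word_reversal σ hi, word_reversal σ (by omega), word_reversal σ hj,
    show n - 1 - i = n - 2 - i + 1 by omega, show n - 1 - (i + 1) = n - 2 - i by omega]
  exact if_congr (by omega) rfl rfl

lemma amax_reversal : amax (reversal σ) = fmax σ := by
  rw [amax_eq_sum, fmax_eq_sum, ← Finset.sum_range_reflect _ n]
  refine Finset.sum_congr rfl fun i hi => ?_
  rw [Finset.mem_range] at hi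
  have hi' : n - 1 - i < n := by omega
  rw [word_reversal σ hi', show n - 1 - (n - 1 - i) = i by omega]
  refine if_congr (and_congr ⟨fun h hin => ?_, fun h h0 => ?_⟩
    ⟨fun h j hj hji => ?_, fun h j hj hji => ?_⟩) rfl rfl
  · have := h (by omega)
    rwa [word_reversal σ (by omega), show n - 1 - (n - 1 - i - 1) = i + 1 by omega] at this
  · rw [word_reversal σ (by omega), show n - 1 - (n - 1 - i - 1) = i + 1 by omega]
    exact h (by omega)
  · have := h (n - 1 - j) (by omega) (by omega)
    rwa [word_reversal σ (by omega), show n - 1 - (n - 1 - j) = j by omega] at this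
  · rw [word_reversal σ hj]
    exact h _ (by omega) (by omega)

end Symmetry

/-! ### All five sums as coefficients of `desSeries` -/

section Sums

variable {K : Type*} [CommSemiring K] (n : ℕ) (t q r : K)

lemma sum_avoiders_132 :
    ∑ σ ∈ avoiders n ![1, 3, 2], t ^ asc σ * q ^ (asc σ + vinc2_13 σ) * r ^ amax σ =
      ∑ σ ∈ avoiders n ![2, 3, 1], t ^ des σ * q ^ (des σ + vinc31_2 σ) * r ^ fmax σ := by
  symm
  refine Finset.sum_nbij' reversal reversal (fun σ hσ => (reversal_mem_132_iff σ).2 hσ)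
    (fun σ hσ => ?_) (fun σ _ => reversal_reversal σ) (fun σ _ => reversal_reversal σ)
    fun σ _ => ?_
  · rwa [← reversal_mem_132_iff, reversal_reversal]
  · rw [asc_reversal, vinc2_13_reversal, amax_reversal]

lemma sum_avoiders_312 :
    ∑ σ ∈ avoiders n ![3, 1, 2], t ^ des σ * q ^ (des σ + vinc2_31 σ) * r ^ amin σ =
      ∑ σ ∈ avoiders n ![1, 3, 2], t ^ asc σ * q ^ (asc σ + vinc2_13 σ) * r ^ amax σ := by
  symm
  refine Finset.sum_nbij' complement complement (fun σ hσ => (complement_mem_312_iff σ).2 hσ)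
    (fun σ hσ => ?_) (fun σ _ => complement_complement σ) (fun σ _ => complement_complement σ)
    fun σ _ => ?_
  · rwa [← complement_mem_312_iff, complement_complement]
  · rw [des_complement, vinc2_31_complement, amin_complement]

lemma sum_avoiders_213 :
    ∑ σ ∈ avoiders n ![2, 1, 3], t ^ asc σ * q ^ (asc σ + vinc13_2 σ) * r ^ fmin σ =
      ∑ σ ∈ avoiders n ![2, 3, 1], t ^ des σ * q ^ (des σ + vinc31_2 σ) * r ^ fmax σ := by
  symm
  refine Finset.sum_nbij' complement complement (fun σ hσ => (complement_mem_213_iff σ).2 hσ)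
    (fun σ hσ => ?_) (fun σ _ => complement_complement σ) (fun σ _ => complement_complement σ)
    fun σ _ => ?_
  · rwa [← complement_mem_213_iff, complement_complement]
  · rw [asc_complement, vinc13_2_complement, fmin_complement]

end Sums

lemma sum_choice_eq_coeff {K : Type*} [CommRing K] {m : ℕ} {c : Choice m} (hc : c ∈ choices m)
    (t q r : K) :
    ∑ σ ∈ avoiders m c.τ, t ^ c.stat₁ σ * q ^ c.stat₂ σ * r ^ c.stat₃ σ =
      PowerSeries.coeff m (desSeries t q r) := by
  simp only [choices, List.mem_cons, List.not_mem_nil, or_false] at hc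
  rcases hc with rfl | rfl | rfl | rfl | rfl
  · exact narayana_eq_coeff m t q r
  · rw [desSeries, PowerSeries.coeff_mk]
  · rw [desSeries, PowerSeries.coeff_mk]
    exact sum_avoiders_132 m t q r
  · rw [desSeries, PowerSeries.coeff_mk]
    exact (sum_avoiders_312 m t q r).trans (sum_avoiders_132 m t q r)
  · rw [desSeries, PowerSeries.coeff_mk]
    exact sum_avoiders_213 m t q r

end QNarayana

theorem mainTheorem10 {K : Type*} [Field K] (n : ℕ) (hn : 1 ≤ n) (t q : K)
    (c : QNarayana.Choice (n - 1)) (hc : c ∈ QNarayana.choices (n - 1)) :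
    (q ≠ 0 →
      QNarayana.narayana n (t / q) q 1 =
        ∑ σ ∈ QNarayana.avoiders (n - 1) c.τ,
          t ^ c.stat₁ σ * q ^ c.stat₂ σ * (1 + t) ^ c.stat₃ σ) ∧
    (t ≠ 0 →
      QNarayana.narayana n t q t =
        t ^ n * ∑ σ ∈ QNarayana.avoiders (n - 1) c.τ,
          (q / t) ^ c.stat₁ σ * q ^ c.stat₂ σ * (1 + q / t) ^ c.stat₃ σ) := by
  obtain ⟨m, rfl⟩ : ∃ m, n = m + 1 := ⟨n - 1, by omega⟩
  rw [QNarayana.sum_choice_eq_coeff hc, QNarayana.sum_choice_eq_coeff hc,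
    QNarayana.narayana_eq_coeff, QNarayana.narayana_eq_coeff, Nat.add_sub_cancel]
  refine ⟨fun hq => ?_, fun ht => ?_⟩
  · rw [QNarayana.desSeries_div_one hq, map_add, PowerSeries.coeff_succ_X_mul,
      PowerSeries.coeff_one, if_neg (Nat.succ_ne_zero m), zero_add]
  · rw [QNarayana.desSeries_self ht, map_add, mul_assoc, PowerSeries.coeff_C_mul,
      PowerSeries.coeff_succ_X_mul, PowerSeries.coeff_rescale, PowerSeries.coeff_one,
      if_neg (Nat.succ_ne_zero m), zero_add]
    ring
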